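/- Let $k\ge 1$ and $N\ge 1$ be integers and let $q\in\mathbb C$ with $|q|<1$. Write $(q)_n=\prod_{i=1}^n(1-q^i)$, $(q)_\infty=\prod_{i\ge1}(1-q^i)$, and ${A\brack B}=\frac{(q)_A}{(q)_B(q)_{A-B}}$ if $0\le B\le A$ and ${A\brack B}=0$ otherwise. Let $\mathcal I$ with $\mathcal I_{i,j}=\delta_{i,j-1}+\delta_{i,j+1}$ be the incidence matrix and $C=2I-\mathcal I$ the Cartan matrix of the Lie algebra $A_{N-1}$ (both of size $(N-1)\times(N-1)$), and let $(\vec e_\ell)_j=\delta_{\ell,j}$ for $1\le j\le N-1$. A sum $\sum_{A-(C^{-1}\vec v)_1\in\mathbb Z}$ runs over all vectors $\vec v$ of $N-1$ non-negative integers for which $A-(C^{-1}\vec v)_1$ is an integer; for $N=1$ it consists of the empty vector only. Fractional powers of $q$ are taken with the principal branch (all total exponents occurring below are integers). Then $$\frac{1}{(q)_\infty}\sum_{j=-\infty}^{\infty}(-1)^j q^{((2k+1+2/N)j+1)j/2}\sum_{\frac jN-(C^{-1}\vec\eta)_1\in\mathbb Z}\frac{q^{\vec\eta\,C^{-1}\vec\eta}}{(q)_{\eta_1}\cdots(q)_{\eta_{N-1}}}$$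 $$=\sum_{r_1\ge\cdots\ge r_k\ge0}\frac{q^{r_1^2/N+r_2^2+\cdots+r_k^2}}{(q)_{r_1-r_2}\cdots(q)_{r_{k-1}-r_k}(q)_{r_k}}\sum_{\frac{r_1}N-(C^{-1}\vec n)_1\in\mathbb Z}q^{\vec n\,C^{-1}\vec n}\prod_{j=1}^{N-1}{m_j+n_j\brack n_j},$$ where $\vec m$ is determined by $\vec n$ and $r_1$ through $\vec m+\vec n=\frac12\left(\mathcal I\,\vec m+2r_1\vec e_{N-1}\right)$, and the double series over $(j,\vec\eta)$ and over $((r_1,\dots,r_k),\vec n)$ converge absolutely. -/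

import Mathlib

namespace HigherBailey

noncomputable section

/-- `(q)_n = (1 - q)(1 - q ^ 2) ⋯ (1 - q ^ n)`. -/
def qPoch (q : ℂ) (n : ℕ) : ℂ := ∏ i ∈ Finset.range n, (1 - q ^ (i + 1))

/-- `(q)_∞ = ∏_{i ≥ 1} (1 - q ^ i)`, a convergent product for `‖q‖ < 1`. -/
def qPochInf (q : ℂ) : ℂ := ∏' i : ℕ, (1 - q ^ (i + 1))

/-- The Gaussian binomial coefficient, `(q)_A / ((q)_B (q)_{A-B})` if `B ≤ A`, and `0` otherwise. -/
def qBinom (q : ℂ) (A B : ℕ) : ℂ :=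
  if B ≤ A then qPoch q A / (qPoch q B * qPoch q (A - B)) else 0

/-- The power `q ^ x` with a rational exponent (principal branch). -/
def qPow (q : ℂ) (x : ℚ) : ℂ := q ^ (x : ℂ)

/-- Integer vectors read as rational vectors. -/
def toRat {d : ℕ} (v : Fin d → ℕ) : Fin d → ℚ := fun i => (v i : ℚ)

/-- The incidence matrix of the Lie algebra `A_{N-1}`: `ℐ_{j,k} = δ_{j,k-1} + δ_{j,k+1}`.
The index `i : Fin (N - 1)` stands for the label `i + 1 ∈ {1, …, N - 1}`. -/
def incidence (N : ℕ) : Matrix (Fin (N - 1)) (Fin (N - 1)) ℚ :=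
  Matrix.of fun i j =>
    (if (i : ℕ) + 1 = j then 1 else 0) + (if (i : ℕ) = (j : ℕ) + 1 then 1 else 0)

/-- The Cartan matrix of the Lie algebra `A_{N-1}`, over `ℚ`. -/
def cartan (N : ℕ) : Matrix (Fin (N - 1)) (Fin (N - 1)) ℚ :=
  (CartanMatrix.A (N - 1)).map (Int.cast : ℤ → ℚ)

/-- The defining relation `C = 2 I - ℐ`. -/
theorem cartan_eq (N : ℕ) : cartan N = (2 : ℚ) • (1 : Matrix _ _ ℚ) - incidence N := by
  ext i j
  simp only [cartan, incidence, CartanMatrix.A, Matrix.map_apply, Matrix.of_apply,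
    Matrix.sub_apply, Matrix.smul_apply, Matrix.one_apply, Fin.ext_iff, smul_eq_mul]
  split_ifs <;> first | (exfalso; omega) | norm_num

/-- The vector `e_ℓ` with components `(e_ℓ)_j = δ_{ℓ,j}`, for labels `j = 1, …, N - 1`. -/
def unitVec (N l : ℕ) : Fin (N - 1) → ℚ := fun i => if (i : ℕ) + 1 = l then 1 else 0

/-- The quadratic form `v C⁻¹ v`. -/
def quadForm (N : ℕ) (v : Fin (N - 1) → ℕ) : ℚ :=
  toRat v ⬝ᵥ ((cartan N)⁻¹).mulVec (toRat v)

/-- The condition `A / N - (C⁻¹ v)_1 ∈ ℤ`, the first component of `C⁻¹ v` being written as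
`e_1 C⁻¹ v` (an empty sum for `N = 1`, where the condition is void). -/
def IntegralShift (N : ℕ) (A : ℤ) (v : Fin (N - 1) → ℕ) : Prop :=
  ∃ z : ℤ, (A : ℚ) / N - unitVec N 1 ⬝ᵥ ((cartan N)⁻¹).mulVec (toRat v) = z

/-- The `(m, n)`-system `m + n = (ℐ m + 2 L e_{N-1}) / 2`. -/
def MNSystem (N L : ℕ) (m n : Fin (N - 1) → ℕ) : Prop :=
  toRat m + toRat n =
    (1 / 2 : ℚ) • ((incidence N).mulVec (toRat m) + (2 * L : ℚ) • unitVec N (N - 1))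

/-- The index set of the inner sum on the left. -/
def EtaIndex (N : ℕ) (j : ℤ) : Type :=
  {η : Fin (N - 1) → ℕ // IntegralShift N j η}

/-- The index set of the inner sum on the right: vectors `n` subject to the integrality condition,
with the companion vector `m` that the `(m, n)`-system attaches to `n`. As `C = 2 I - ℐ` is
invertible, `n` determines `m`. If the solution `m` has a negative component, the product of
Gaussian binomials for `n` is zero, and `n` is left out. -/
def MNIndex (N L : ℕ) : Type :=
  {p : (Fin (N - 1) → ℕ) × (Fin (N - 1) → ℕ) // IntegralShift N L p.2 ∧ MNSystem N L p.1 p.2}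

/-- The index set of the outer sum on the right: `r_1 ≥ … ≥ r_k ≥ 0`. -/
def RIndex (k : ℕ) : Type := {r : Fin k → ℕ // Antitone r}

/-- `part r i` is `r_i` for the labels `i = 1, …, k`, and `part r (k + 1) = 0`. -/
def part {k : ℕ} (r : RIndex k) (i : ℕ) : ℕ :=
  if h : i - 1 < k then r.1 ⟨i - 1, h⟩ else 0

/-- `(-1) ^ j q ^ (((2k + 1 + 2/N) j + 1) j / 2)`. -/
def outerLeft (q : ℂ) (k N : ℕ) (j : ℤ) : ℂ :=
  (-1) ^ j * qPow q (((2 * k + 1 + 2 / N) * j + 1) * j / 2)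

/-- `q ^ (η C⁻¹ η) / ((q)_{η_1} ⋯ (q)_{η_{N-1}})`. -/
def innerLeft (q : ℂ) (N : ℕ) (η : Fin (N - 1) → ℕ) : ℂ :=
  qPow q (quadForm N η) / ∏ i, qPoch q (η i)

/-- `q ^ (r_1² / N + r_2² + ⋯ + r_k²) / ((q)_{r_1 - r_2} ⋯ (q)_{r_{k-1} - r_k} (q)_{r_k})`. -/
def outerRight (q : ℂ) (k N : ℕ) (r : RIndex k) : ℂ :=
  qPow q ((part r 1 : ℚ) ^ 2 / N + ∑ i ∈ Finset.Icc 2 k, (part r i : ℚ) ^ 2) /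
    ∏ i ∈ Finset.Icc 1 k, qPoch q (part r i - part r (i + 1))

/-- `q ^ (n C⁻¹ n) ∏_j [m_j + n_j, n_j]`. -/
def innerRight (q : ℂ) (N : ℕ) (m n : Fin (N - 1) → ℕ) : ℂ :=
  qPow q (quadForm N n) * ∏ i, qBinom q (m i + n i) (n i)

end

end HigherBailey

/-!
A convex integer path `0 = K_0, K_1, …, K_N = L` encodes a vector `v` of an inner sum by its second
differences `v_i = K_{i-1} - 2 K_i + K_{i+1}`. Then `(C⁻¹ v)_i = i L / N - K_i`, so that integrality
of the path is the condition `L / N - (C⁻¹ v)_1 ∈ ℤ`; moreover `L² / N + v C⁻¹ v` is the sum of the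
squares of the steps of the path, and the solution of the `(m, n)`-system is `m = 2 K`. Both inner
sums are therefore partition functions of paths with weights between neighbouring vertices.

A single summation formula, obtained from the `q`-Vandermonde and `q`-Chu–Vandermonde sums, trades
one Gaussian binomial for one reciprocal `q`-factorial at a vertex and moves on to the next vertex.
After all vertices are exchanged, letting the free parameter tend to infinity shows that the two
partition functions form a conjugate Bailey pair. Pairing it with the `k`-th Bailey pair in the
Bailey chain of the unit pair, whose unrolled form is the sum over `r_1 ≥ ⋯ ≥ r_k`, gives the
identity. The argument involves negative powers of `q`, so `q = 0` is treated on its own: there each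
side consists of a single term.
-/

namespace HigherBailey

noncomputable section

open Filter Topology

variable {q : ℂ}

/-! ### Reciprocal `q`-factorials and Gaussian binomials with integer arguments -/

/-- `1 / (q)_n` for an integer `n`. The value `0` for `n < 0` is forced by the recurrence
`recPoch q n * (1 - q ^ n) = recPoch q (n - 1)`, and lets all sums run over `ℤ`. -/
def recPoch (q : ℂ) (n : ℤ) : ℂ := if 0 ≤ n then (qPoch q n.toNat)⁻¹ else 0

/-- The Gaussian binomial coefficient `(1 - q ^ n) ⋯ (1 - q ^ (n - k + 1)) / (q)_k` for integers
`n` and `k`. In contrast to `qBinom`, it need not vanish for `n < 0`. -/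
def gauss (q : ℂ) (n k : ℤ) : ℂ :=
  (∏ i ∈ Finset.range k.toNat, (1 - q ^ (n - i))) * recPoch q k

theorem recPoch_of_neg (q : ℂ) {n : ℤ} (hn : n < 0) : recPoch q n = 0 :=
  if_neg hn.not_ge

theorem recPoch_of_nonneg (q : ℂ) {n : ℤ} (hn : 0 ≤ n) : recPoch q n = (qPoch q n.toNat)⁻¹ :=
  if_pos hn

theorem recPoch_natCast (q : ℂ) (n : ℕ) : recPoch q n = (qPoch q n)⁻¹ :=
  recPoch_of_nonneg q n.cast_nonneg

@[simp] theorem recPoch_zero (q : ℂ) : recPoch q 0 = 1 := by simp [recPoch, qPoch]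

theorem one_sub_pow_succ_ne_zero (hq : ‖q‖ < 1) (i : ℕ) : 1 - q ^ (i + 1) ≠ 0 := fun h => by
  have hlt : ‖q ^ (i + 1)‖ < 1 := by
    rw [norm_pow]
    exact pow_lt_one₀ (norm_nonneg q) hq i.succ_ne_zero
  rw [← sub_eq_zero.mp h, norm_one] at hlt
  exact hlt.false

theorem qPoch_ne_zero (hq : ‖q‖ < 1) (n : ℕ) : qPoch q n ≠ 0 :=
  Finset.prod_ne_zero_iff.mpr fun i _ => one_sub_pow_succ_ne_zero hq i

theorem recPoch_ne_zero (hq : ‖q‖ < 1) {n : ℤ} (hn : 0 ≤ n) : recPoch q n ≠ 0 := by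
  rw [recPoch_of_nonneg q hn]
  exact inv_ne_zero (qPoch_ne_zero hq _)

theorem recPoch_mul_one_sub (hq : ‖q‖ < 1) (n : ℤ) :
    recPoch q n * (1 - q ^ n) = recPoch q (n - 1) := by
  rcases lt_trichotomy n 0 with hn | rfl | hn
  · rw [recPoch_of_neg q hn, recPoch_of_neg q (by omega), zero_mul]
  · rw [recPoch_of_neg q (by omega : (0 : ℤ) - 1 < 0), zpow_zero, sub_self, mul_zero]
  · obtain ⟨m, rfl⟩ : ∃ m : ℕ, n = (m + 1 : ℕ) := ⟨(n - 1).toNat, by omega⟩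
    have hsucc : qPoch q (m + 1) = qPoch q m * (1 - q ^ (m + 1)) := Finset.prod_range_succ _ m
    rw [Nat.cast_succ, add_sub_cancel_right, ← Nat.cast_succ, recPoch_natCast, recPoch_natCast,
      zpow_natCast, Nat.succ_eq_add_one, hsucc, mul_inv,
      inv_mul_cancel_right₀ (one_sub_pow_succ_ne_zero hq m)]

theorem prod_one_sub_mul_recPoch (hq : ‖q‖ < 1) (n : ℤ) (k : ℕ) :
    (∏ i ∈ Finset.range k, (1 - q ^ (n - i))) * recPoch q n = recPoch q (n - k) := by
  induction k with
  | zero => simp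
  | succ k ih =>
    rw [Finset.prod_range_succ, mul_right_comm, ih, recPoch_mul_one_sub hq, Nat.cast_succ,
      sub_sub]

theorem gauss_of_neg_right (q : ℂ) (n : ℤ) {k : ℤ} (hk : k < 0) : gauss q n k = 0 := by
  rw [gauss, recPoch_of_neg q hk, mul_zero]

@[simp] theorem gauss_zero_right (q : ℂ) (n : ℤ) : gauss q n 0 = 1 := by simp [gauss]

theorem gauss_mul_recPoch (hq : ‖q‖ < 1) (n k : ℤ) :
    gauss q n k * recPoch q n = recPoch q k * recPoch q (n - k) := by
  rcases lt_or_ge k 0 with hk | hk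
  · rw [gauss_of_neg_right q n hk, recPoch_of_neg q hk, zero_mul, zero_mul]
  · lift k to ℕ using hk
    rw [gauss, mul_right_comm, Int.toNat_natCast, prod_one_sub_mul_recPoch hq, mul_comm]

theorem gauss_eq_mul_qPoch (hq : ‖q‖ < 1) {n : ℤ} (hn : 0 ≤ n) (k : ℤ) :
    gauss q n k = recPoch q k * recPoch q (n - k) * qPoch q n.toNat := by
  rw [← gauss_mul_recPoch hq, recPoch_of_nonneg q hn,
    inv_mul_cancel_right₀ (qPoch_ne_zero hq _)]

theorem gauss_of_lt (hq : ‖q‖ < 1) {n k : ℤ} (hn : 0 ≤ n) (hk : n < k) : gauss q n k = 0 := by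
  rw [gauss_eq_mul_qPoch hq hn, recPoch_of_neg q (by omega : n - k < 0), mul_zero, zero_mul]

theorem gauss_zero_left (hq : ‖q‖ < 1) {k : ℤ} (hk : k ≠ 0) : gauss q 0 k = 0 := by
  rcases lt_or_gt_of_ne hk with hk | hk
  · exact gauss_of_neg_right q 0 hk
  · exact gauss_of_lt hq le_rfl hk

theorem gauss_natCast (hq : ‖q‖ < 1) (n k : ℕ) : gauss q n k = qBinom q n k := by
  rcases lt_or_ge n k with hk | hk
  · rw [gauss_of_lt hq n.cast_nonneg (by omega), qBinom, if_neg (by omega)]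
  · rw [gauss_eq_mul_qPoch hq n.cast_nonneg, ← Nat.cast_sub hk, recPoch_natCast, recPoch_natCast,
      Int.toNat_natCast, qBinom, if_pos hk, div_eq_inv_mul, mul_inv]

theorem gauss_pascal (hq0 : q ≠ 0) (hq : ‖q‖ < 1) (n k : ℤ) :
    gauss q n k = q ^ k * gauss q (n - 1) k + gauss q (n - 1) (k - 1) := by
  rcases lt_trichotomy k 0 with hk | rfl | hk
  · simp [gauss_of_neg_right q _ hk, gauss_of_neg_right q _ (by omega : k - 1 < 0)]
  · simp [gauss_of_neg_right q _ (by omega : (-1 : ℤ) < 0)]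
  · obtain ⟨m, rfl⟩ : ∃ m : ℕ, k = m + 1 := ⟨(k - 1).toNat, by omega⟩
    have hprod : ∏ i ∈ Finset.range (m + 1), (1 - q ^ (n - i)) =
        (1 - q ^ n) * ∏ i ∈ Finset.range m, (1 - q ^ (n - 1 - i)) := by
      rw [Finset.prod_range_succ', mul_comm]
      simp only [Nat.cast_zero, sub_zero, Nat.cast_succ, sub_sub, add_comm (1 : ℤ)]
    have hpow : q ^ n = q ^ ((m : ℤ) + 1) * q ^ (n - 1 - m) := by
      rw [← zpow_add₀ hq0]
      ring_nf
    rw [gauss, gauss, gauss, add_sub_cancel_right, Int.toNat_natCast, Int.toNat_natCast_add_one,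
      hprod, Finset.prod_range_succ, ← add_sub_cancel_right (m : ℤ) 1, ← recPoch_mul_one_sub hq,
      add_sub_cancel_right, hpow]
    ring

/-! ### Bounds and limits -/

theorem tendsto_qPoch (hq : ‖q‖ < 1) : Tendsto (qPoch q) atTop (𝓝 (qPochInf q)) :=
  (ModularForm.multipliable_one_sub_pow hq).hasProd.tendsto_prod_nat

theorem qPochInf_ne_zero (hq : ‖q‖ < 1) : qPochInf q ≠ 0 := by
  have hprod := tprod_one_add_ne_zero_of_summable (f := fun n : ℕ => -q ^ (n + 1))
    (fun i => by simpa [sub_eq_add_neg] using one_sub_pow_succ_ne_zero hq i)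
    (by simpa using (summable_nat_add_iff 1).mpr (summable_geometric_of_lt_one (norm_nonneg _) hq))
  simpa [qPochInf, sub_eq_add_neg] using hprod

theorem tendsto_recPoch (hq : ‖q‖ < 1) : Tendsto (recPoch q) atTop (𝓝 (qPochInf q)⁻¹) := by
  have htoNat : Tendsto Int.toNat atTop atTop :=
    tendsto_atTop_atTop.mpr fun b => ⟨b, fun a ha => by omega⟩
  refine (((tendsto_qPoch hq).inv₀ (qPochInf_ne_zero hq)).comp htoNat).congr' ?_
  filter_upwards [eventually_ge_atTop 0] with n hn
  exact (recPoch_of_nonneg q hn).symm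

theorem tendsto_gauss_atTop (hq : ‖q‖ < 1) (a k : ℤ) :
    Tendsto (fun n : ℤ => gauss q (a + n) k) atTop (𝓝 (recPoch q k)) := by
  have hinf : (qPochInf q)⁻¹ ≠ 0 := inv_ne_zero (qPochInf_ne_zero hq)
  have hnum := (tendsto_recPoch hq).comp (tendsto_atTop_add_const_left atTop (a - k) tendsto_id)
  have hden := (tendsto_recPoch hq).comp (tendsto_atTop_add_const_left atTop a tendsto_id)
  have hlim := (hnum.const_mul (recPoch q k)).div hden hinf
  rw [mul_div_cancel_right₀ _ hinf] at hlim
  refine hlim.congr' ?_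
  filter_upwards [eventually_ge_atTop (-a)] with n hn
  simp only [Pi.div_apply, Function.comp_apply, id_eq, sub_add_eq_add_sub]
  rw [← gauss_mul_recPoch hq, mul_div_cancel_right₀ _ (recPoch_ne_zero hq (by omega))]

theorem exists_norm_qPoch_le (hq : ‖q‖ < 1) : ∃ C : ℝ, ∀ n, ‖qPoch q n‖ ≤ C :=
  (tendsto_qPoch hq).norm.bddAbove_range.imp fun _ hC n => hC ⟨n, rfl⟩

theorem exists_norm_recPoch_le (hq : ‖q‖ < 1) : ∃ C : ℝ, ∀ n, ‖recPoch q n‖ ≤ C := by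
  obtain ⟨C, hC⟩ := ((tendsto_qPoch hq).inv₀ (qPochInf_ne_zero hq)).norm.bddAbove_range
  have hC' (n : ℕ) : ‖(qPoch q n)⁻¹‖ ≤ C := hC ⟨n, rfl⟩
  refine ⟨C, fun n => ?_⟩
  rcases lt_or_ge n 0 with hn | hn
  · rw [recPoch_of_neg q hn, norm_zero]
    exact (norm_nonneg _).trans (hC' 0)
  · rw [recPoch_of_nonneg q hn]
    exact hC' _

theorem exists_norm_recPoch_mul_recPoch_le (hq : ‖q‖ < 1) :
    ∃ B : ℝ, ∀ m n : ℤ, ‖recPoch q m * recPoch q n‖ ≤ B := by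
  obtain ⟨B, hB⟩ := exists_norm_recPoch_le hq
  refine ⟨B * B, fun m n => ?_⟩
  rw [norm_mul]
  exact mul_le_mul (hB m) (hB n) (norm_nonneg _) ((norm_nonneg _).trans (hB m))

theorem exists_norm_gauss_le_of_nonneg (hq : ‖q‖ < 1) :
    ∃ C : ℝ, ∀ n k : ℤ, 0 ≤ n → ‖gauss q n k‖ ≤ C := by
  obtain ⟨A, hA⟩ := exists_norm_recPoch_le hq
  obtain ⟨B, hB⟩ := exists_norm_qPoch_le hq
  have hA0 : 0 ≤ A := (norm_nonneg _).trans (hA 0)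
  refine ⟨A * A * B, fun n k hn => ?_⟩
  rw [gauss_eq_mul_qPoch hq hn, norm_mul, norm_mul]
  gcongr
  exacts [hA _, hA _, hB _]

/-- The triangular number `k (k - 1) / 2`; the division is exact. -/
def tri (k : ℤ) : ℤ := k * (k - 1) / 2

theorem two_mul_tri (k : ℤ) : 2 * tri k = k * (k - 1) :=
  Int.mul_ediv_cancel' (Int.even_mul_pred_self k).two_dvd

theorem tri_add_one (k : ℤ) : tri (k + 1) = tri k + k := by
  have hk := two_mul_tri k
  have hk' := two_mul_tri (k + 1)
  linarith

theorem prod_neg_zpow_sub (hq0 : q ≠ 0) (n : ℤ) (k : ℕ) :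
    ∏ i ∈ Finset.range k, -q ^ (n - i) = (-1) ^ k * q ^ (n * k - tri k) := by
  induction k with
  | zero => simp [tri]
  | succ k ih =>
    have hexp : n * (k + 1 : ℕ) - tri (k + 1 : ℕ) = (n * k - tri k) + (n - k) := by
      rw [Nat.cast_succ, tri_add_one]
      ring
    rw [Finset.prod_range_succ, ih, hexp, zpow_add₀ hq0, pow_succ]
    ring

theorem gauss_neg_left (hq0 : q ≠ 0) (n : ℤ) (k : ℕ) :
    gauss q (-n) k = (-1) ^ k * q ^ (-n * k - tri k) * gauss q (n + k - 1) k := by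
  have hfactor (i : ℕ) : 1 - q ^ (-n - i) = -q ^ (-n - i) * (1 - q ^ (n + i)) := by
    have hinv : q ^ (-n - i) * q ^ (n + i) = 1 := by
      rw [← zpow_add₀ hq0, neg_sub_left, add_comm n, neg_add_cancel, zpow_zero]
    linear_combination -hinv
  have hreflect : ∏ i ∈ Finset.range k, (1 - q ^ (n + i)) =
      ∏ i ∈ Finset.range k, (1 - q ^ (n + k - 1 - i)) := by
    rw [← Finset.prod_range_reflect]
    refine Finset.prod_congr rfl fun i hi => ?_
    have := Finset.mem_range.mp hi
    congr 2
    omega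
  rw [gauss, gauss, Int.toNat_natCast, ← mul_assoc, ← prod_neg_zpow_sub hq0, ← hreflect,
    ← Finset.prod_mul_distrib, Finset.prod_congr rfl fun i _ => hfactor i]

theorem exists_norm_gauss_le (hq0 : q ≠ 0) (hq : ‖q‖ < 1) :
    ∃ C : ℝ, ∀ n k : ℤ, ‖gauss q n k‖ ≤ C * (1 + ‖q‖ ^ (n * k - tri k)) := by
  obtain ⟨C, hC⟩ := exists_norm_gauss_le_of_nonneg hq
  have hC0 : 0 ≤ C := (norm_nonneg _).trans (hC 0 0 le_rfl)
  refine ⟨C, fun n k => ?_⟩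
  have hpow : 0 ≤ ‖q‖ ^ (n * k - tri k) := by positivity
  rcases le_or_gt 0 n with hn | hn
  · exact (hC n k hn).trans (le_mul_of_one_le_right hC0 (by linarith))
  rcases lt_or_ge k 0 with hk | hk
  · rw [gauss_of_neg_right q n hk, norm_zero]
    positivity
  · lift k to ℕ using hk
    have hneg := gauss_neg_left hq0 (-n) k
    rw [neg_neg] at hneg
    calc ‖gauss q n k‖ = ‖q‖ ^ (n * k - tri k) * ‖gauss q (-n + k - 1) k‖ := by
          rw [hneg]
          simp
      _ ≤ ‖q‖ ^ (n * k - tri k) * C := by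
          gcongr
          exact hC _ _ (by omega)
      _ ≤ C * (1 + ‖q‖ ^ (n * k - tri k)) := by linarith

theorem mul_abs_sub_sq_le (a b s : ℤ) : a * |s| - (a + |b|) ^ 2 ≤ s ^ 2 + b * s := by
  have hbs : -(|b| * |s|) ≤ b * s := by
    rw [← abs_mul]
    exact neg_abs_le _
  nlinarith [sq_abs s, sq_nonneg (|s| - (a + |b|)), sq_nonneg (a + |b|), sq_nonneg |s|]

theorem summable_zpow_abs {r : ℝ} (h0 : 0 ≤ r) (h1 : r < 1) : Summable fun s : ℤ => r ^ |s| := by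
  have hgeom := summable_geometric_of_lt_one h0 h1
  rw [summable_int_iff_summable_nat_and_neg]
  exact ⟨by simpa using hgeom, by simpa using hgeom⟩

theorem summable_zpow_sq {r : ℝ} (h0 : 0 < r) (h1 : r < 1) : Summable fun s : ℤ => r ^ s ^ 2 :=
  (summable_zpow_abs h0.le h1).of_nonneg_of_le (fun s => by positivity) fun s =>
    zpow_le_zpow_right_of_le_one₀ h0 h1.le <| by
      rw [← sq_abs]
      exact Int.le_self_sq _

theorem zpow_le_of_abs_sub_le {r : ℝ} (h0 : 0 < r) (h1 : r < 1) {e s D : ℤ}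
    (he : |s| - D ≤ e) : r ^ e ≤ r ^ (-D) * r ^ |s| := by
  rw [← zpow_add₀ h0.ne']
  exact zpow_le_zpow_right_of_le_one₀ h0 h1.le (by linarith)

/- The exponent `s ^ 2` outweighs the growth of `gauss q (x + n) k` in `k = s + x + l`: their sum is
half of a positive definite quadratic form in `s` and `x`. -/
theorem exists_norm_zpow_mul_gauss_le (hq0 : q ≠ 0) (hq : ‖q‖ < 1) (a n l : ℤ) :
    ∃ C : ℝ, ∀ s x : ℤ, ‖q ^ (s ^ 2 + a * s) * gauss q (x + n) (s + x + l)‖ ≤ C * ‖q‖ ^ |s| := by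
  have hρ : 0 < ‖q‖ := norm_pos_iff.mpr hq0
  obtain ⟨C, hC⟩ := exists_norm_gauss_le hq0 hq
  have hC0 : 0 ≤ C := nonneg_of_mul_nonneg_left ((norm_nonneg _).trans (hC 0 0)) (by positivity)
  set b : ℤ := 2 * (a + n - l) + 1
  set c : ℤ := 2 * n + 1
  set D : ℤ := (2 + |b|) ^ 2 + |c| ^ 2 + |l * (2 * n + 1 - l)|
  have hle (s x : ℤ) :
      |s| - D ≤ s ^ 2 + a * s + ((x + n) * (s + x + l) - tri (s + x + l)) := by
    have hs := mul_abs_sub_sq_le 2 b s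
    have hx := mul_abs_sub_sq_le 0 c x
    have hconst := neg_abs_le (l * (2 * n + 1 - l))
    have htri := two_mul_tri (s + x + l)
    have hD0 : 0 ≤ D := by positivity
    have hdouble : 2 * (s ^ 2 + a * s + ((x + n) * (s + x + l) - tri (s + x + l))) =
        s ^ 2 + b * s + (x ^ 2 + c * x) + l * (2 * n + 1 - l) := by
      linear_combination -htri
    rw [zero_mul, zero_add] at hx
    linarith
  refine ⟨C * (‖q‖ ^ (-(2 + |a|) ^ 2) + ‖q‖ ^ (-D)), fun s x => ?_⟩
  have hle' : |s| - (2 + |a|) ^ 2 ≤ s ^ 2 + a * s := by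
    linarith [mul_abs_sub_sq_le 2 a s, abs_nonneg s]
  calc ‖q ^ (s ^ 2 + a * s) * gauss q (x + n) (s + x + l)‖
      ≤ ‖q‖ ^ (s ^ 2 + a * s) *
          (C * (1 + ‖q‖ ^ ((x + n) * (s + x + l) - tri (s + x + l)))) := by
        rw [norm_mul, norm_zpow]
        gcongr
        exact hC _ _
    _ = C * (‖q‖ ^ (s ^ 2 + a * s) +
          ‖q‖ ^ (s ^ 2 + a * s + ((x + n) * (s + x + l) - tri (s + x + l)))) := by
        rw [zpow_add₀ hρ.ne' (s ^ 2 + a * s)]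
        ring
    _ ≤ C * (‖q‖ ^ (-(2 + |a|) ^ 2) * ‖q‖ ^ |s| + ‖q‖ ^ (-D) * ‖q‖ ^ |s|) := by
        gcongr
        · exact zpow_le_of_abs_sub_le hρ hq hle'
        · exact zpow_le_of_abs_sub_le hρ hq (hle s x)
    _ = C * (‖q‖ ^ (-(2 + |a|) ^ 2) + ‖q‖ ^ (-D)) * ‖q‖ ^ |s| := by ring

/-! ### The `q`-Vandermonde and `q`-Chu–Vandermonde sums -/

theorem hasSum_gauss_mul_gauss (hq0 : q ≠ 0) (hq : ‖q‖ < 1) (m : ℕ) (n k : ℤ) :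
    HasSum (fun t : ℤ => gauss q m t * gauss q n (k - t) * q ^ ((m - t) * (k - t)))
      (gauss q (m + n) k) := by
  induction m generalizing k with
  | zero =>
    convert hasSum_single (0 : ℤ) fun t ht => ?_ using 1
    · simp
    · rw [Nat.cast_zero, gauss_zero_left hq ht, zero_mul, zero_mul]
  | succ m ih =>
    have hshift := (Equiv.subRight (1 : ℤ)).hasSum_iff.mpr (ih (k - 1))
    have hpascal := gauss_pascal hq0 hq ((m + 1 : ℕ) + n) k
    rw [show ((m + 1 : ℕ) : ℤ) + n - 1 = m + n by push_cast; ring] at hpascal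
    rw [hpascal]
    refine (((ih k).mul_left (q ^ k)).add hshift).congr_fun fun t => ?_
    have hpow : q ^ t * q ^ (((m + 1 : ℕ) - t) * (k - t)) = q ^ k * q ^ ((m - t) * (k - t)) := by
      rw [← zpow_add₀ hq0, ← zpow_add₀ hq0]
      push_cast
      ring_nf
    have hexp : (m - (t - 1)) * (k - t) = ((m + 1 : ℕ) - t) * (k - t) := by
      push_cast
      ring
    rw [gauss_pascal hq0 hq, Nat.cast_succ, add_sub_cancel_right, ← Nat.cast_succ]
    simp only [Function.comp_apply, Equiv.subRight_apply, sub_sub_sub_cancel_right, hexp]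
    linear_combination (gauss q m t * gauss q n (k - t)) * hpow

theorem gauss_add_eq_sum (hq0 : q ≠ 0) (hq : ‖q‖ < 1) (m : ℕ) (n k : ℤ) :
    gauss q (m + n) k =
      ∑ t ∈ Finset.Icc 0 k, gauss q m t * gauss q n (k - t) * q ^ ((m - t) * (k - t)) := by
  refine (hasSum_gauss_mul_gauss hq0 hq m n k).unique
    (hasSum_sum_of_ne_finset_zero fun t ht => ?_)
  rcases not_and_or.mp (Finset.mem_Icc.not.mp ht) with ht | ht
  · rw [gauss_of_neg_right q m (by omega), zero_mul, zero_mul]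
  · rw [gauss_of_neg_right q n (by omega), mul_zero, zero_mul]

theorem summable_zpow_mul_gauss_mul (hq0 : q ≠ 0) (hq : ‖q‖ < 1) (a n l : ℤ) {g : ℤ → ℂ} {B : ℝ}
    (hg : ∀ s, ‖g s‖ ≤ B) :
    Summable fun s : ℤ => q ^ (s ^ 2 + a * s) * gauss q n (s + l) * g s := by
  obtain ⟨C, hC⟩ := exists_norm_zpow_mul_gauss_le hq0 hq a n l
  refine (((summable_zpow_abs (norm_nonneg q) hq).mul_left C).mul_right B).of_norm_bounded
    fun s => ?_
  have hs := hC s 0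
  rw [zero_add, add_zero] at hs
  rw [norm_mul]
  exact mul_le_mul hs (hg s) (norm_nonneg _) ((norm_nonneg _).trans hs)

/-- The summand of the `q`-Chu–Vandermonde sum; it runs over all integers, and its upper entry `n`
may be negative. -/
def chuVandermondeTerm (q : ℂ) (n c s : ℤ) : ℂ :=
  q ^ (s * (s + c)) * gauss q n (s + c) * recPoch q s

/- The terms for `(n, c)` and `(n - 1, c - 1)` differ by a telescoping summable sequence. -/
theorem hasSum_chuVandermondeTerm_iff (hq0 : q ≠ 0) (hq : ‖q‖ < 1) (n c : ℤ) (A : ℂ) :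
    HasSum (chuVandermondeTerm q n c) A ↔ HasSum (chuVandermondeTerm q (n - 1) (c - 1)) A := by
  obtain ⟨B, hB⟩ := exists_norm_recPoch_le hq
  let G (s : ℤ) : ℂ :=
    q ^ (s ^ 2 + (c - 1) * s) * gauss q (n - 1) (s + (c - 1)) * recPoch q (s - 1)
  have hG : Summable G :=
    summable_zpow_mul_gauss_mul hq0 hq _ _ _ (g := fun s => recPoch q (s - 1)) fun s => hB _
  have hdiff (s : ℤ) :
      chuVandermondeTerm q n c s - chuVandermondeTerm q (n - 1) (c - 1) s = G (s + 1) - G s := by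
    have hpow : q ^ (s * (s + c)) = q ^ (s ^ 2 + (c - 1) * s) * q ^ s := by
      rw [← zpow_add₀ hq0]
      ring_nf
    have hpow' : q ^ ((s + 1) ^ 2 + (c - 1) * (s + 1)) =
        q ^ (s ^ 2 + (c - 1) * s) * q ^ s * q ^ (s + c) := by
      rw [← zpow_add₀ hq0, ← zpow_add₀ hq0]
      ring_nf
    have hexp : s * (s + (c - 1)) = s ^ 2 + (c - 1) * s := by ring
    have hrec := recPoch_mul_one_sub hq s
    simp only [chuVandermondeTerm, G, gauss_pascal hq0 hq n, hpow, hpow', hexp,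
      add_sub_cancel_right, add_assoc s 1, add_sub_cancel, add_sub_assoc s c]
    rw [← hrec]
    ring
  have htelescope : HasSum (fun s => G (s + 1) - G s) 0 := by
    rw [← sub_self (∑' s, G s)]
    exact ((Equiv.addRight (1 : ℤ)).hasSum_iff.mpr hG.hasSum).sub hG.hasSum
  constructor <;> intro h
  · simpa [← hdiff] using h.sub htelescope
  · simpa [← hdiff] using h.add htelescope

theorem hasSum_chuVandermondeTerm (hq0 : q ≠ 0) (hq : ‖q‖ < 1) (n c : ℤ) :
    HasSum (chuVandermondeTerm q n c) (recPoch q (n - c)) := by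
  have hbase (c : ℤ) : HasSum (chuVandermondeTerm q 0 c) (recPoch q (-c)) := by
    convert hasSum_single (-c) fun s hs => ?_ using 1
    · simp [chuVandermondeTerm]
    · rw [chuVandermondeTerm, gauss_zero_left hq (by omega), mul_zero, zero_mul]
  have hshift (m c : ℤ) : HasSum (chuVandermondeTerm q m (c + m)) (recPoch q (-c)) := by
    induction m with
    | zero => simpa using hbase c
    | succ m ih =>
      rw [hasSum_chuVandermondeTerm_iff hq0 hq]
      simpa [← add_assoc] using ih
    | pred m ih =>
      rw [hasSum_chuVandermondeTerm_iff hq0 hq] at ih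
      simpa [add_sub_assoc] using ih
  simpa using hshift n (c - n)

/-- The Gaussian binomial `gauss q n k`, replaced by `0` for `n < 0`; it is bounded in `n`
and `k`. -/
def gaussTrunc (q : ℂ) (n k : ℤ) : ℂ := if 0 ≤ n then gauss q n k else 0

theorem gaussTrunc_of_nonneg (q : ℂ) {n : ℤ} (hn : 0 ≤ n) (k : ℤ) :
    gaussTrunc q n k = gauss q n k := if_pos hn

theorem gaussTrunc_of_neg (q : ℂ) {n : ℤ} (hn : n < 0) (k : ℤ) : gaussTrunc q n k = 0 :=
  if_neg hn.not_ge

theorem gaussTrunc_of_neg_right (q : ℂ) (n : ℤ) {k : ℤ} (hk : k < 0) : gaussTrunc q n k = 0 := by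
  rw [gaussTrunc, gauss_of_neg_right q n hk, ite_self]

theorem gaussTrunc_of_lt (hq : ‖q‖ < 1) {n k : ℤ} (hk : n < k) : gaussTrunc q n k = 0 := by
  rcases lt_or_ge n 0 with hn | hn
  · exact gaussTrunc_of_neg q hn k
  · rw [gaussTrunc_of_nonneg q hn, gauss_of_lt hq hn hk]

theorem exists_norm_gaussTrunc_le (hq : ‖q‖ < 1) : ∃ C : ℝ, ∀ n k : ℤ, ‖gaussTrunc q n k‖ ≤ C := by
  obtain ⟨C, hC⟩ := exists_norm_gauss_le_of_nonneg hq
  refine ⟨C, fun n k => ?_⟩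
  rcases lt_or_ge n 0 with hn | hn
  · rw [gaussTrunc_of_neg q hn, norm_zero]
    exact (norm_nonneg _).trans (hC 0 0 le_rfl)
  · rw [gaussTrunc_of_nonneg q hn]
    exact hC n k hn

theorem gauss_mul_recPoch_of_lt_abs (q : ℂ) (n : ℤ) {z l z' : ℤ} (hz : z < |l|) (hz' : z' ≤ z - l) :
    gauss q n (z + l) * recPoch q z' = 0 := by
  rcases lt_abs.mp hz with hz | hz
  · rw [recPoch_of_neg q (by omega), mul_zero]
  · rw [gauss_of_neg_right q n (by omega), zero_mul]

theorem gaussTrunc_mul_gauss_mul_recPoch (hq0 : q ≠ 0) (hq : ‖q‖ < 1) {y : ℤ} (hy : 0 ≤ y)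
    (k n z l : ℤ) :
    gaussTrunc q (y + z) k * (gauss q n (z + l) * recPoch q (z - l)) =
      ∑ t ∈ Finset.Icc 0 k, recPoch q t * gauss q (y + l) (k - t) *
        (q ^ ((z - l - t) * (k - t)) * (gauss q n (z + l) * recPoch q (z - l - t))) := by
  rcases lt_or_ge z |l| with hz | hz
  · rw [gauss_mul_recPoch_of_lt_abs q n hz le_rfl, mul_zero]
    refine (Finset.sum_eq_zero fun t ht => ?_).symm
    have ht0 : 0 ≤ t := (Finset.mem_Icc.mp ht).1
    rw [gauss_mul_recPoch_of_lt_abs q n hz (by omega), mul_zero, mul_zero]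
  · have hl := abs_le.mp hz
    obtain ⟨m, hm⟩ := Int.eq_ofNat_of_zero_le (by omega : 0 ≤ z - l)
    have hvandermonde := gauss_add_eq_sum hq0 hq m (y + l) k
    rw [← hm, show z - l + (y + l) = y + z by ring] at hvandermonde
    rw [gaussTrunc_of_nonneg q (by omega), hvandermonde, Finset.sum_mul]
    refine Finset.sum_congr rfl fun t _ => ?_
    linear_combination (gauss q (y + l) (k - t) * q ^ ((z - l - t) * (k - t)) *
      gauss q n (z + l)) * gauss_mul_recPoch hq (z - l) t

theorem hasSum_zpow_mul_gauss_mul_recPoch (hq0 : q ≠ 0) (hq : ‖q‖ < 1) (x n l t : ℤ) :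
    HasSum (fun z : ℤ => q ^ (z - x) ^ 2 * (q ^ ((z - l - t) * (2 * x - t)) *
        (gauss q (x + n) (z + l) * recPoch q (z - l - t))))
      (q ^ (l + t - x) ^ 2 * recPoch q (x + n - (2 * l + t))) := by
  have hsum := (hasSum_chuVandermondeTerm hq0 hq (x + n) (2 * l + t)).mul_left
    (q ^ (l + t - x) ^ 2)
  refine ((Equiv.subRight (l + t)).hasSum_iff.mpr hsum).congr_fun fun z => ?_
  have hpow : q ^ (z - x) ^ 2 * q ^ ((z - l - t) * (2 * x - t)) =
      q ^ (l + t - x) ^ 2 * q ^ ((z - l - t) * (z + l)) := by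
    rw [← zpow_add₀ hq0, ← zpow_add₀ hq0]
    ring_nf
  have hidx : z - l - t + (2 * l + t) = z + l := by ring
  simp only [Function.comp_apply, Equiv.subRight_apply, chuVandermondeTerm, ← sub_sub z l t, hidx]
  linear_combination (gauss q (x + n) (z + l) * recPoch q (z - l - t)) * hpow

/- Expanding `gaussTrunc q (y + z) (2 * x)` by the `q`-Vandermonde sum makes the sum over `z` a
`q`-Chu–Vandermonde sum for each `t = x - p`. -/
theorem tsum_bailey_kernel (hq0 : q ≠ 0) (hq : ‖q‖ < 1) {y : ℤ} (hy : 0 ≤ y) (x n l : ℤ) :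
    ∑' z : ℤ, q ^ (z - x) ^ 2 * gaussTrunc q (y + z) (2 * x) *
        (gauss q (x + n) (z + l) * recPoch q (z - l)) =
      ∑' p : ℤ, q ^ (l - p) ^ 2 * recPoch q (n - 2 * l + p) *
        (gauss q (y + l) (x + p) * recPoch q (x - p)) := by
  have hsum := hasSum_sum fun t (_ : t ∈ Finset.Icc 0 (2 * x)) =>
    (hasSum_zpow_mul_gauss_mul_recPoch hq0 hq x n l t).mul_left
      (recPoch q t * gauss q (y + l) (2 * x - t))
  have hexpand (z : ℤ) : q ^ (z - x) ^ 2 * gaussTrunc q (y + z) (2 * x) *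
        (gauss q (x + n) (z + l) * recPoch q (z - l)) =
      ∑ t ∈ Finset.Icc 0 (2 * x), recPoch q t * gauss q (y + l) (2 * x - t) *
        (q ^ (z - x) ^ 2 * (q ^ ((z - l - t) * (2 * x - t)) *
          (gauss q (x + n) (z + l) * recPoch q (z - l - t)))) := by
    rw [mul_assoc, gaussTrunc_mul_gauss_mul_recPoch hq0 hq hy, Finset.mul_sum]
    exact Finset.sum_congr rfl fun t _ => by ring
  rw [tsum_congr hexpand, hsum.tsum_eq, ← (Equiv.subLeft x).tsum_eq]
  simp only [Equiv.subLeft_apply]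
  rw [tsum_eq_sum (s := Finset.Icc 0 (2 * x)) fun t ht => ?_]
  · refine Finset.sum_congr rfl fun t _ => ?_
    rw [sub_sub_cancel, show x + (x - t) = 2 * x - t by ring,
      show n - 2 * l + (x - t) = x + n - (2 * l + t) by ring,
      show l - (x - t) = l + t - x by ring]
    ring
  · rcases not_and_or.mp (Finset.mem_Icc.not.mp ht) with ht | ht
    · rw [recPoch_of_neg q (by omega : x - (x - t) < 0), mul_zero, mul_zero]
    · rw [gauss_of_neg_right q _ (by omega : x + (x - t) < 0), zero_mul, mul_zero]

/-! ### Transfer weights and integer paths -/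

/-- Total weight of the integer paths `0 = K_0, …, K_d = x, K_{d+1} = z`, in which a step from `a`
to `b` has weight `q ^ (b - a) ^ 2` and an interior vertex `x` between `y` and `z` has weight
`κ y x z`. For `d = 0` the only path is `0, z`, and `x = 0`. -/
def transferWeight (q : ℂ) (κ : ℤ → ℤ → ℤ → ℂ) : ℕ → ℤ → ℤ → ℂ
  | 0, x, z => if x = 0 then q ^ z ^ 2 else 0
  | d + 1, x, z => q ^ (z - x) ^ 2 * ∑' y, κ y x z * transferWeight q κ d y x

/-- The path `0, K_1, …, K_d, z, z, …`. -/
def pathExt {d : ℕ} (K : Fin d → ℤ) (z : ℤ) (i : ℕ) : ℤ :=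
  if i = 0 then 0 else if h : i - 1 < d then K ⟨i - 1, h⟩ else z

/-- The weight of the single path `0, K_1, …, K_d, z`; compare `transferWeight`. -/
def pathWeight (q : ℂ) (κ : ℤ → ℤ → ℤ → ℂ) {d : ℕ} (K : Fin d → ℤ) (z : ℤ) : ℂ :=
  q ^ (∑ i ∈ Finset.range (d + 1), (pathExt K z (i + 1) - pathExt K z i) ^ 2) *
    ∏ i ∈ Finset.range d, κ (pathExt K z i) (pathExt K z (i + 1)) (pathExt K z (i + 2))

@[simp] theorem pathExt_zero {d : ℕ} (K : Fin d → ℤ) (z : ℤ) : pathExt K z 0 = 0 :=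
  if_pos rfl

theorem pathExt_succ {d : ℕ} (K : Fin d → ℤ) (z : ℤ) {i : ℕ} (hi : i < d) :
    pathExt K z (i + 1) = K ⟨i, hi⟩ := by simp [pathExt, hi]

@[simp] theorem pathExt_last {d : ℕ} (K : Fin d → ℤ) (z : ℤ) : pathExt K z (d + 1) = z := by
  simp [pathExt]

theorem pathExt_snoc {d : ℕ} (K : Fin d → ℤ) (x z : ℤ) {i : ℕ} (hi : i ≤ d + 1) :
    pathExt (Fin.snoc K x : Fin (d + 1) → ℤ) z i = pathExt K x i := by
  rcases i with _ | i
  · simp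
  rw [pathExt_succ _ _ hi]
  rcases (Nat.le_of_succ_le_succ hi).lt_or_eq with hid | rfl
  · rw [pathExt_succ _ _ hid]
    exact Fin.snoc_castSucc (α := fun _ => ℤ) x K ⟨i, hid⟩
  · rw [pathExt_last]
    exact Fin.snoc_last (α := fun _ => ℤ) x K

theorem pathWeight_snoc (hq0 : q ≠ 0) (κ : ℤ → ℤ → ℤ → ℂ) {d : ℕ} (K : Fin d → ℤ) (x z : ℤ) :
    pathWeight q κ (Fin.snoc K x : Fin (d + 1) → ℤ) z =
      pathWeight q κ K x * (q ^ (z - x) ^ 2 * κ (pathExt K x d) x z) := by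
  let K' : Fin (d + 1) → ℤ := Fin.snoc K x
  have hlast : pathExt K' z (d + 2) = z := pathExt_last _ _
  have hsnoc {i : ℕ} (hi : i ≤ d + 1) : pathExt K' z i = pathExt K x i := pathExt_snoc K x z hi
  have hsum : ∑ i ∈ Finset.range (d + 1), (pathExt K' z (i + 1) - pathExt K' z i) ^ 2 =
      ∑ i ∈ Finset.range (d + 1), (pathExt K x (i + 1) - pathExt K x i) ^ 2 :=
    Finset.sum_congr rfl fun i hi => by
      have := Finset.mem_range.mp hi
      rw [hsnoc (by omega), hsnoc (by omega)]
  have hprod : ∏ i ∈ Finset.range d, κ (pathExt K' z i) (pathExt K' z (i + 1))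
        (pathExt K' z (i + 2)) =
      ∏ i ∈ Finset.range d, κ (pathExt K x i) (pathExt K x (i + 1)) (pathExt K x (i + 2)) :=
    Finset.prod_congr rfl fun i hi => by
      have := Finset.mem_range.mp hi
      rw [hsnoc (by omega), hsnoc (by omega), hsnoc (by omega)]
  rw [pathWeight, Finset.sum_range_succ, Finset.prod_range_succ, hsum, hprod, hlast,
    hsnoc le_rfl, hsnoc d.le_succ, pathExt_last, zpow_add₀ hq0, pathWeight]
  ring

theorem summable_mul_comp_sub {α : Type*} {f : α → ℝ} (hf : Summable f) (hf0 : ∀ a, 0 ≤ f a)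
    {h : ℤ → ℝ} (hh : Summable h) (hh0 : ∀ s, 0 ≤ h s) (g : α → ℤ) :
    Summable fun p : α × ℤ => f p.1 * h (p.2 - g p.1) := by
  refine (hf.mul_of_nonneg hh hf0 hh0).comp_injective (i := fun p : α × ℤ => (p.1, p.2 - g p.1)) ?_
  rintro ⟨a, s⟩ ⟨a', s'⟩ heq
  simp only [Prod.mk.injEq] at heq
  obtain ⟨rfl, hs⟩ := heq
  rw [sub_left_injective hs]

theorem summable_mul_zpow_sub_sq {r : ℝ} (h0 : 0 < r) (h1 : r < 1) {α : Type*} {f : α → ℝ}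
    (hf : Summable f) (hf0 : ∀ a, 0 ≤ f a) (g : α → ℤ) :
    Summable fun p : α × ℤ => f p.1 * r ^ (p.2 - g p.1) ^ 2 :=
  summable_mul_comp_sub hf hf0 (summable_zpow_sq h0 h1) (fun _ => by positivity) g

section BoundedKernel

variable {κ : ℤ → ℤ → ℤ → ℂ} {C : ℝ}

theorem norm_transferWeight_succ_le (hκ : ∀ y x z, ‖κ y x z‖ ≤ C) {d : ℕ} {x : ℤ}
    (hs : Summable fun y => ‖transferWeight q κ d y x‖) (z : ℤ) :
    ‖transferWeight q κ (d + 1) x z‖ ≤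
      C * (∑' y, ‖transferWeight q κ d y x‖) * ‖q‖ ^ (z - x) ^ 2 := by
  rw [transferWeight, norm_mul, norm_zpow, mul_comm, ← tsum_mul_left]
  gcongr
  refine tsum_of_norm_bounded (hs.mul_left C).hasSum fun y => ?_
  rw [norm_mul]
  gcongr
  exact hκ _ _ _

theorem summable_norm_transferWeight (hq0 : q ≠ 0) (hq : ‖q‖ < 1) (hκ : ∀ y x z, ‖κ y x z‖ ≤ C)
    (d : ℕ) : Summable fun p : ℤ × ℤ => ‖transferWeight q κ d p.1 p.2‖ := by
  have hρ : 0 < ‖q‖ := norm_pos_iff.mpr hq0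
  have hC : 0 ≤ C := (norm_nonneg _).trans (hκ 0 0 0)
  induction d with
  | zero =>
    have hsingle : Summable fun x : ℤ => if x = 0 then (1 : ℝ) else 0 :=
      (hasSum_ite_eq 0 1).summable
    refine (summable_mul_zpow_sub_sq hρ hq hsingle (fun x => by positivity) id).congr fun p => ?_
    rw [transferWeight]
    split_ifs with hp
    · simp [hp]
    · simp
  | succ d ih =>
    have hsum := ih.prod_symm.prod.mul_left C
    have hsum0 (x : ℤ) : 0 ≤ C * ∑' y, ‖transferWeight q κ d y x‖ :=
      mul_nonneg hC (tsum_nonneg fun _ => norm_nonneg _)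
    exact (summable_mul_zpow_sub_sq hρ hq hsum hsum0 id).of_nonneg_of_le
      (fun _ => norm_nonneg _) fun p =>
        norm_transferWeight_succ_le hκ (ih.prod_symm.prod_factor p.1) p.2

theorem exists_norm_transferWeight_le (hq0 : q ≠ 0) (hq : ‖q‖ < 1)
    (hκ : ∀ y x z, ‖κ y x z‖ ≤ C) (d : ℕ) :
    ∃ D : ℝ, ∀ x z, ‖transferWeight q κ d x z‖ ≤ D * ‖q‖ ^ (z - x) ^ 2 := by
  cases d with
  | zero =>
    refine ⟨1, fun x z => ?_⟩
    rw [transferWeight]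
    split_ifs with hx
    · simp [hx]
    · rw [norm_zero]
      positivity
  | succ d =>
    have hC : 0 ≤ C := (norm_nonneg _).trans (hκ 0 0 0)
    have hs := (summable_norm_transferWeight hq0 hq hκ d).prod_symm
    refine ⟨C * ∑' x, ∑' y, ‖transferWeight q κ d y x‖, fun x z =>
      (norm_transferWeight_succ_le hκ (hs.prod_factor x) z).trans ?_⟩
    refine mul_le_mul_of_nonneg_right (mul_le_mul_of_nonneg_left ?_ hC) (by positivity)
    exact hs.prod.le_tsum x fun _ _ => tsum_nonneg fun _ => norm_nonneg _

theorem summable_norm_pathWeight (hq0 : q ≠ 0) (hq : ‖q‖ < 1) (hκ : ∀ y x z, ‖κ y x z‖ ≤ C)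
    (d : ℕ) : Summable fun p : (Fin d → ℤ) × ℤ => ‖pathWeight q κ p.1 p.2‖ := by
  have hρ : 0 < ‖q‖ := norm_pos_iff.mpr hq0
  have hC : 0 ≤ C := (norm_nonneg _).trans (hκ 0 0 0)
  induction d with
  | zero =>
    refine (Equiv.uniqueProd ℤ (Fin 0 → ℤ)).symm.summable_iff.mp ?_
    simpa [Function.comp_def, pathWeight, pathExt] using summable_zpow_sq hρ hq
  | succ d ih =>
    have hprod := summable_mul_zpow_sub_sq hρ hq (ih.mul_left C) (fun _ => by positivity) Prod.snd
    let e : ((Fin d → ℤ) × ℤ) × ℤ ≃ (Fin (d + 1) → ℤ) × ℤ :=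
      ((Equiv.prodComm _ _).trans (Fin.snocEquiv fun _ => ℤ)).prodCongr (Equiv.refl ℤ)
    refine e.summable_iff.mp (hprod.of_nonneg_of_le (fun _ => norm_nonneg _) ?_)
    rintro ⟨⟨K, x⟩, z⟩
    change ‖pathWeight q κ (Fin.snoc K x : Fin (d + 1) → ℤ) z‖ ≤ _
    rw [pathWeight_snoc hq0, norm_mul, norm_mul, norm_zpow, mul_comm (‖q‖ ^ _), ← mul_assoc,
      mul_comm _ ‖κ _ _ _‖]
    gcongr
    exact hκ _ _ _

/- The test function `φ` of the last interior vertex is what the induction needs. -/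
theorem tsum_pathWeight_mul (hq0 : q ≠ 0) (hq : ‖q‖ < 1) (hκ : ∀ y x z, ‖κ y x z‖ ≤ C) (d : ℕ)
    (x : ℤ) {φ : ℤ → ℂ} {B : ℝ} (hφ : ∀ y, ‖φ y‖ ≤ B) :
    ∑' K : Fin d → ℤ, pathWeight q κ K x * φ (pathExt K x d) =
      ∑' y, transferWeight q κ d y x * φ y := by
  induction d generalizing x φ B with
  | zero =>
    rw [tsum_eq_single (0 : ℤ) fun y hy => by simp [transferWeight, hy],
      tsum_eq_single (default : Fin 0 → ℤ) fun K hK => (hK (Subsingleton.elim _ _)).elim]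
    simp [pathWeight, transferWeight, pathExt]
  | succ d ih =>
    let e : ℤ × (Fin d → ℤ) ≃ (Fin (d + 1) → ℤ) := Fin.snocEquiv fun _ => ℤ
    have hsummable :
        Summable fun K : Fin (d + 1) → ℤ => pathWeight q κ K x * φ (pathExt K x (d + 1)) := by
      have hpath := (summable_norm_pathWeight hq0 hq hκ (d + 1)).prod_symm.prod_factor x
      refine (hpath.mul_right B).of_norm_bounded fun K => ?_
      rw [norm_mul]
      exact mul_le_mul_of_nonneg_left (hφ _) (norm_nonneg _)
    have hsnoc : ∀ p : ℤ × (Fin d → ℤ), pathWeight q κ (e p) x * φ (pathExt (e p) x (d + 1)) =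
        q ^ (x - p.1) ^ 2 * φ p.1 * (pathWeight q κ p.2 p.1 * κ (pathExt p.2 p.1 d) p.1 x) := by
      rintro ⟨y, K⟩
      change pathWeight q κ (Fin.snoc K y : Fin (d + 1) → ℤ) x *
        φ (pathExt (Fin.snoc K y : Fin (d + 1) → ℤ) x (d + 1)) = _
      rw [pathWeight_snoc hq0, pathExt_snoc K y x le_rfl, pathExt_last]
      ring
    have hsummable' := e.summable_iff.mpr hsummable
    simp only [Function.comp_def, hsnoc] at hsummable'
    rw [← e.tsum_eq, tsum_congr hsnoc, hsummable'.tsum_prod]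
    refine tsum_congr fun y => ?_
    dsimp only
    rw [tsum_mul_left, ih y (φ := fun y' => κ y' y x) (fun y' => hκ y' y x), transferWeight,
      mul_right_comm]
    simp only [mul_comm (κ _ _ _)]

theorem tsum_pathWeight (hq0 : q ≠ 0) (hq : ‖q‖ < 1) (hκ : ∀ y x z, ‖κ y x z‖ ≤ C) (d : ℕ)
    (x : ℤ) : ∑' K : Fin d → ℤ, pathWeight q κ K x = ∑' y, transferWeight q κ d y x := by
  simpa using tsum_pathWeight_mul hq0 hq hκ d x (φ := fun _ => 1) (B := 1) (by simp)

end BoundedKernel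

/-! ### The conjugate Bailey pair of level `d + 1` -/

/-- `(δ, γ)` is a conjugate Bailey pair (relative to `a = 1`); as `1 / (q)_n = 0` for `n < 0`, the
sum over `r ≥ |l|` is written as a sum over all integers. -/
def IsConjugateBaileyPair (q : ℂ) (δ γ : ℤ → ℂ) : Prop :=
  ∀ l, γ l = ∑' r, δ r * (recPoch q (r - l) * recPoch q (r + l))

/-- The vertex weight of a path on the side of the `(m, n)`-system. -/
def gaussKernel (q : ℂ) (y x z : ℤ) : ℂ := gaussTrunc q (y + z) (2 * x)

/-- The vertex weight of a path on the side of the vectors `η`. -/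
def etaKernel (q : ℂ) (y x z : ℤ) : ℂ := recPoch q (y + z - 2 * x)

theorem exists_norm_gaussKernel_le (hq : ‖q‖ < 1) : ∃ C : ℝ, ∀ y x z, ‖gaussKernel q y x z‖ ≤ C :=
  let ⟨C, h⟩ := exists_norm_gaussTrunc_le hq
  ⟨C, fun _ _ _ => h _ _⟩

theorem exists_norm_etaKernel_le (hq : ‖q‖ < 1) : ∃ C : ℝ, ∀ y x z, ‖etaKernel q y x z‖ ≤ C :=
  let ⟨C, h⟩ := exists_norm_recPoch_le hq
  ⟨C, fun _ _ _ => h _⟩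

theorem transferWeight_gaussKernel_of_neg (q : ℂ) (d : ℕ) {x : ℤ} (hx : x < 0) (z : ℤ) :
    transferWeight q (gaussKernel q) d x z = 0 := by
  cases d with
  | zero => exact if_neg hx.ne
  | succ d =>
    have hx' : 2 * x < 0 := by omega
    simp only [transferWeight, gaussKernel, gaussTrunc_of_neg_right q _ hx', zero_mul, tsum_zero,
      mul_zero]

theorem summable_transferWeight_mul_kernel_left (hq0 : q ≠ 0) (hq : ‖q‖ < 1) (d : ℕ) (l n : ℤ) :
    Summable fun s : (ℤ × ℤ) × ℤ => transferWeight q (gaussKernel q) d s.1.1 s.1.2 *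
      (q ^ (s.2 - s.1.2) ^ 2 * gaussTrunc q (s.1.1 + s.2) (2 * s.1.2) *
        (gauss q (s.1.2 + n) (s.2 + l) * recPoch q (s.2 - l))) := by
  obtain ⟨G, hG⟩ := exists_norm_gaussTrunc_le hq
  obtain ⟨B, hB⟩ := exists_norm_recPoch_le hq
  obtain ⟨C, hC⟩ := exists_norm_zpow_mul_gauss_le hq0 hq 0 n l
  have hG0 : 0 ≤ G := (norm_nonneg _).trans (hG 0 0)
  have hC0 : 0 ≤ C := by simpa using (norm_nonneg _).trans (hC 0 0)
  have hw := summable_norm_transferWeight hq0 hq (κ := gaussKernel q) (fun _ _ _ => hG _ _) d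
  have hsum := summable_mul_comp_sub hw (fun _ => norm_nonneg _)
    (summable_zpow_abs (norm_nonneg q) hq) (fun _ => by positivity) Prod.snd
  refine (hsum.mul_left (G * C * B)).of_norm_bounded fun ⟨⟨y, x⟩, z⟩ => ?_
  have hpow : ‖q ^ (z - x) ^ 2 * gauss q (x + n) (z + l)‖ ≤ C * ‖q‖ ^ |z - x| := by
    simpa using hC (z - x) x
  calc _ = ‖transferWeight q (gaussKernel q) d y x‖ * (‖gaussTrunc q (y + z) (2 * x)‖ *
        ‖q ^ (z - x) ^ 2 * gauss q (x + n) (z + l)‖ * ‖recPoch q (z - l)‖) := by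
        simp only [norm_mul]
        ring
    _ ≤ ‖transferWeight q (gaussKernel q) d y x‖ * (G * (C * ‖q‖ ^ |z - x|) * B) := by
        gcongr
        exacts [hG _ _, hB _]
    _ = _ := by ring

theorem abs_add_abs_add_abs_sub_le {x p : ℤ} (hp : p ≤ x) (hp' : 0 ≤ x + p) (l y : ℤ) :
    |y| + |x| + |x - p| - ((3 + |2 * l|) ^ 2 + (5 + |2 * l|) ^ 2) ≤
      (x - y) ^ 2 + ((l - p) ^ 2 + ((y + l) * (x + p) - tri (x + p))) := by
  have hexp : 2 * ((x - y) ^ 2 + ((l - p) ^ 2 + ((y + l) * (x + p) - tri (x + p)))) =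
      ((x - p - y) ^ 2 + 2 * l * (x - p - y)) + (y ^ 2 + 2 * l * y) + (x + p) + 2 * l ^ 2 := by
    linear_combination -two_mul_tri (x + p)
  have h1 := mul_abs_sub_sq_le 3 (2 * l) (x - p - y)
  have h2 := mul_abs_sub_sq_le 5 (2 * l) y
  have h3 : x - p - |y| ≤ |x - p - y| := by
    have := abs_sub_abs_le_abs_sub (x - p) y
    rwa [abs_of_nonneg (by omega : 0 ≤ x - p)] at this
  rw [abs_of_nonneg (by omega : 0 ≤ x), abs_of_nonneg (by omega : 0 ≤ x - p)]
  nlinarith [sq_nonneg l, sq_nonneg (3 + |2 * l|), sq_nonneg (5 + |2 * l|), abs_nonneg y]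

theorem exists_norm_transferWeight_mul_zpow_le (hq0 : q ≠ 0) (hq : ‖q‖ < 1) {κ : ℤ → ℤ → ℤ → ℂ}
    {C : ℝ} (hκ : ∀ y x z, ‖κ y x z‖ ≤ C) (d : ℕ) (l : ℤ) :
    ∃ A : ℝ, ∀ y x p, p ≤ x → 0 ≤ x + p →
      ‖transferWeight q κ d y x‖ * (‖q‖ ^ (l - p) ^ 2 * ‖q‖ ^ ((y + l) * (x + p) - tri (x + p))) ≤
        A * (‖q‖ ^ |y| * ‖q‖ ^ |x| * ‖q‖ ^ |p - x|) := by
  have hρ : 0 < ‖q‖ := norm_pos_iff.mpr hq0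
  obtain ⟨D, hD⟩ := exists_norm_transferWeight_le hq0 hq hκ d
  have hD0 : 0 ≤ D := nonneg_of_mul_nonneg_left ((norm_nonneg _).trans (hD 0 0)) (by positivity)
  let E := (3 + |2 * l|) ^ 2 + (5 + |2 * l|) ^ 2
  refine ⟨D * ‖q‖ ^ (-E), fun y x p hp hp' => ?_⟩
  set e := (y + l) * (x + p) - tri (x + p)
  have hexp : ‖q‖ ^ ((x - y) ^ 2 + ((l - p) ^ 2 + e)) ≤
      ‖q‖ ^ (-E) * (‖q‖ ^ |y| * ‖q‖ ^ |x| * ‖q‖ ^ |p - x|) := by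
    have hle := abs_add_abs_add_abs_sub_le hp hp' l y
    rw [abs_sub_comm x p] at hle
    rw [← zpow_add₀ hρ.ne', ← zpow_add₀ hρ.ne', ← abs_of_nonneg
      (by positivity : 0 ≤ |y| + |x| + |p - x|)]
    exact zpow_le_of_abs_sub_le hρ hq (by rwa [abs_of_nonneg (by positivity)])
  calc _ ≤ D * ‖q‖ ^ (x - y) ^ 2 * (‖q‖ ^ (l - p) ^ 2 * ‖q‖ ^ e) := by
        gcongr
        exact hD y x
    _ = D * ‖q‖ ^ ((x - y) ^ 2 + ((l - p) ^ 2 + e)) := by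
        rw [mul_assoc, ← zpow_add₀ hρ.ne', ← zpow_add₀ hρ.ne']
    _ ≤ _ := by
        rw [mul_assoc]
        gcongr

theorem exists_norm_transferWeight_mul_kernel_right_le (hq0 : q ≠ 0) (hq : ‖q‖ < 1) (d : ℕ)
    (l n : ℤ) : ∃ A A' : ℝ, ∀ y x p, ‖transferWeight q (gaussKernel q) d y x *
      (q ^ (l - p) ^ 2 * recPoch q (n - 2 * l + p) *
        (gauss q (y + l) (x + p) * recPoch q (x - p)))‖ ≤
      A * (‖transferWeight q (gaussKernel q) d y x‖ * ‖q‖ ^ (p - l) ^ 2) +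
        A' * (‖q‖ ^ |y| * ‖q‖ ^ |x| * ‖q‖ ^ |p - x|) := by
  obtain ⟨G, hG⟩ := exists_norm_gaussKernel_le hq
  obtain ⟨B, hB⟩ := exists_norm_recPoch_le hq
  obtain ⟨C, hC⟩ := exists_norm_gauss_le hq0 hq
  obtain ⟨A, hA⟩ := exists_norm_transferWeight_mul_zpow_le hq0 hq hG d l
  have hB0 : 0 ≤ B := (norm_nonneg _).trans (hB 0)
  have hC0 : 0 ≤ C := nonneg_of_mul_nonneg_left ((norm_nonneg _).trans (hC 0 0)) (by positivity)
  have hA0 : 0 ≤ A := nonneg_of_mul_nonneg_left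
    (le_trans (by positivity) (hA 0 0 0 le_rfl le_rfl)) (by positivity)
  refine ⟨B * B * C, B * B * C * A, fun y x p => ?_⟩
  rcases le_or_gt p x with hp | hp
  swap
  · rw [recPoch_of_neg q (by omega : x - p < 0), mul_zero, mul_zero, mul_zero, norm_zero]
    positivity
  rcases le_or_gt 0 (x + p) with hp' | hp'
  swap
  · rw [gauss_of_neg_right q _ hp', zero_mul, mul_zero, mul_zero, norm_zero]
    positivity
  set w := ‖transferWeight q (gaussKernel q) d y x‖
  set e := (y + l) * (x + p) - tri (x + p)
  calc _ = ‖recPoch q (n - 2 * l + p)‖ * ‖recPoch q (x - p)‖ * ‖gauss q (y + l) (x + p)‖ *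
        (w * ‖q‖ ^ (l - p) ^ 2) := by
        simp only [norm_mul, norm_zpow]
        ring
    _ ≤ B * B * (C * (1 + ‖q‖ ^ e)) * (w * ‖q‖ ^ (l - p) ^ 2) := by
        gcongr
        exacts [hB _, hB _, hC _ _]
    _ = B * B * C * (w * ‖q‖ ^ (p - l) ^ 2) +
        B * B * C * (w * (‖q‖ ^ (l - p) ^ 2 * ‖q‖ ^ e)) := by
        rw [sub_sq_comm p l]
        ring
    _ ≤ _ := by
        rw [mul_assoc _ A]
        exact add_le_add le_rfl (mul_le_mul_of_nonneg_left (hA y x p hp hp') (by positivity))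

theorem summable_transferWeight_mul_kernel_right (hq0 : q ≠ 0) (hq : ‖q‖ < 1) (d : ℕ) (l n : ℤ) :
    Summable fun s : (ℤ × ℤ) × ℤ => transferWeight q (gaussKernel q) d s.1.1 s.1.2 *
      (q ^ (l - s.2) ^ 2 * recPoch q (n - 2 * l + s.2) *
        (gauss q (s.1.1 + l) (s.1.2 + s.2) * recPoch q (s.1.2 - s.2))) := by
  obtain ⟨G, hG⟩ := exists_norm_gaussKernel_le hq
  obtain ⟨A, A', hA⟩ := exists_norm_transferWeight_mul_kernel_right_le hq0 hq d l n
  have habs := summable_zpow_abs (norm_nonneg q) hq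
  have h1 := summable_mul_zpow_sub_sq (norm_pos_iff.mpr hq0) hq
    (summable_norm_transferWeight hq0 hq hG d) (fun _ => norm_nonneg _) fun _ => l
  have h2 := summable_mul_comp_sub
    (habs.mul_of_nonneg habs (fun _ => by positivity) fun _ => by positivity)
    (fun _ => by positivity) habs (fun _ => by positivity) Prod.snd
  exact ((h1.mul_left A).add (h2.mul_left A')).of_norm_bounded fun s => hA s.1.1 s.1.2 s.2

/-- A finite form of the sequence `γ` of the conjugate Bailey pair, tending to it as `n → ∞`. -/
def finiteGamma (q : ℂ) (d : ℕ) (l n : ℤ) : ℂ :=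
  ∑' p : ℤ × ℤ, transferWeight q (gaussKernel q) d p.1 p.2 *
    (gauss q (p.1 + n) (p.2 + l) * recPoch q (p.2 - l))

theorem finiteGamma_zero (hq0 : q ≠ 0) (hq : ‖q‖ < 1) (l n : ℤ) :
    finiteGamma q 0 l n = q ^ l ^ 2 * recPoch q (n - 2 * l) := by
  have hsupport : Function.support (fun p : ℤ × ℤ => transferWeight q (gaussKernel q) 0 p.1 p.2 *
      (gauss q (p.1 + n) (p.2 + l) * recPoch q (p.2 - l))) ⊆ Set.range (Prod.mk (0 : ℤ)) := by
    rintro ⟨x, z⟩ h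
    have hx : x = 0 := by
      by_contra hx
      simp [transferWeight, hx] at h
    exact ⟨z, by rw [hx]⟩
  rw [finiteGamma, ← (Prod.mk_right_injective (0 : ℤ)).tsum_eq hsupport,
    ← (hasSum_chuVandermondeTerm hq0 hq n (2 * l)).tsum_eq, ← tsum_mul_left,
    ← (Equiv.addRight l).tsum_eq]
  refine tsum_congr fun s => ?_
  have hexp : (s + l) ^ 2 = l ^ 2 + s * (s + 2 * l) := by ring
  rw [Equiv.coe_addRight, transferWeight, if_pos rfl, zero_add, add_sub_cancel_right, add_assoc,
    ← two_mul, hexp, zpow_add₀ hq0, chuVandermondeTerm]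
  ring

theorem finiteGamma_succ_eq_tsum (hq0 : q ≠ 0) (hq : ‖q‖ < 1) (d : ℕ) (l n : ℤ) :
    finiteGamma q (d + 1) l n =
      ∑' s : (ℤ × ℤ) × ℤ, transferWeight q (gaussKernel q) d s.1.1 s.1.2 *
        (q ^ (s.2 - s.1.2) ^ 2 * gaussTrunc q (s.1.1 + s.2) (2 * s.1.2) *
          (gauss q (s.1.2 + n) (s.2 + l) * recPoch q (s.2 - l))) := by
  let e : (ℤ × ℤ) × ℤ ≃ (ℤ × ℤ) × ℤ :=
    { toFun := fun s => ((s.2, s.1.1), s.1.2)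
      invFun := fun s => ((s.1.2, s.2), s.1.1) }
  have hsum := e.summable_iff.mpr (summable_transferWeight_mul_kernel_left hq0 hq d l n)
  rw [← e.tsum_eq]
  refine Eq.trans (tsum_congr fun r => ?_) hsum.tsum_prod.symm
  rw [transferWeight, mul_right_comm, ← tsum_mul_left]
  refine tsum_congr fun y => ?_
  simp only [Function.comp_apply, e, Equiv.coe_fn_mk, gaussKernel]
  ring

theorem finiteGamma_succ (hq0 : q ≠ 0) (hq : ‖q‖ < 1) (d : ℕ) (l n : ℤ) :
    finiteGamma q (d + 1) l n =
      ∑' p : ℤ, q ^ (l - p) ^ 2 * recPoch q (n - 2 * l + p) * finiteGamma q d p l := by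
  have hL := summable_transferWeight_mul_kernel_left hq0 hq d l n
  have hR := summable_transferWeight_mul_kernel_right hq0 hq d l n
  let f (r : ℤ × ℤ) (p : ℤ) : ℂ := transferWeight q (gaussKernel q) d r.1 r.2 *
    (q ^ (l - p) ^ 2 * recPoch q (n - 2 * l + p) *
      (gauss q (r.1 + l) (r.2 + p) * recPoch q (r.2 - p)))
  calc finiteGamma q (d + 1) l n = ∑' (r : ℤ × ℤ) (p : ℤ), f r p := by
        rw [finiteGamma_succ_eq_tsum hq0 hq, hL.tsum_prod]
        refine tsum_congr fun r => ?_
        dsimp only [f]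
        rw [tsum_mul_left, tsum_mul_left]
        rcases lt_or_ge r.1 0 with hr | hr
        · rw [transferWeight_gaussKernel_of_neg q d hr, zero_mul, zero_mul]
        · rw [tsum_bailey_kernel hq0 hq hr]
    _ = ∑' (p : ℤ) (r : ℤ × ℤ), f r p := (Summable.tsum_comm (f := f) hR).symm
    _ = _ := by
        refine tsum_congr fun p => ?_
        rw [finiteGamma, ← tsum_mul_left]
        exact tsum_congr fun r => by ring

theorem finiteGamma_eq (hq0 : q ≠ 0) (hq : ‖q‖ < 1) (d : ℕ) (l n : ℤ) :
    finiteGamma q d l n =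
      ∑' y : ℤ, recPoch q (n - 2 * l + y) * transferWeight q (etaKernel q) d y l := by
  induction d generalizing l n with
  | zero =>
    rw [finiteGamma_zero hq0 hq, tsum_eq_single (0 : ℤ) fun y hy => by simp [transferWeight, hy]]
    simp [transferWeight, mul_comm]
  | succ d ih =>
    rw [finiteGamma_succ hq0 hq]
    refine tsum_congr fun p => ?_
    have hkernel (y : ℤ) : recPoch q (l - 2 * p + y) = etaKernel q y p l := by
      rw [etaKernel]
      ring_nf
    simp only [ih, hkernel, transferWeight]
    ring

/-- The sequence `δ` of the conjugate Bailey pair of level `d + 1`. -/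
def levelDelta (q : ℂ) (d : ℕ) (r : ℤ) : ℂ := ∑' x, transferWeight q (gaussKernel q) d x r

/-- The sequence `γ` of the conjugate Bailey pair of level `d + 1`. -/
def levelGamma (q : ℂ) (d : ℕ) (l : ℤ) : ℂ :=
  (qPochInf q)⁻¹ * ∑' y, transferWeight q (etaKernel q) d y l

theorem tendsto_finiteGamma (hq0 : q ≠ 0) (hq : ‖q‖ < 1) (d : ℕ) (l : ℤ) :
    Tendsto (finiteGamma q d l) atTop
      (𝓝 (∑' p : ℤ × ℤ, transferWeight q (gaussKernel q) d p.1 p.2 *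
        (recPoch q (p.2 + l) * recPoch q (p.2 - l)))) := by
  obtain ⟨B, hB⟩ := exists_norm_recPoch_le hq
  obtain ⟨C, hC⟩ := exists_norm_gauss_le_of_nonneg hq
  obtain ⟨G, hG⟩ := exists_norm_gaussKernel_le hq
  have hC0 : 0 ≤ C := (norm_nonneg _).trans (hC 0 0 le_rfl)
  refine tendsto_tsum_of_dominated_convergence
    ((summable_norm_transferWeight hq0 hq hG d).mul_right (C * B))
    (fun p => ((tendsto_gauss_atTop hq _ _).mul_const _).const_mul _) ?_
  filter_upwards [eventually_ge_atTop 0] with n hn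
  rintro ⟨x, z⟩
  rcases lt_or_ge x 0 with hx | hx
  · simp [transferWeight_gaussKernel_of_neg q d hx]
  · rw [norm_mul, norm_mul]
    gcongr
    exacts [hC _ _ (add_nonneg hx hn), hB _]

theorem tendsto_finiteGamma_levelGamma (hq0 : q ≠ 0) (hq : ‖q‖ < 1) (d : ℕ) (l : ℤ) :
    Tendsto (finiteGamma q d l) atTop (𝓝 (levelGamma q d l)) := by
  obtain ⟨B, hB⟩ := exists_norm_recPoch_le hq
  obtain ⟨E, hE⟩ := exists_norm_etaKernel_le hq
  have hsum := (summable_norm_transferWeight hq0 hq hE d).prod_symm.prod_factor l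
  rw [funext (finiteGamma_eq hq0 hq d l), levelGamma, ← tsum_mul_left]
  refine tendsto_tsum_of_dominated_convergence (hsum.mul_left B) (fun y => ?_) ?_
  · have hshift : Tendsto (fun n : ℤ => n - 2 * l + y) atTop atTop :=
      tendsto_atTop_add_const_right _ y (tendsto_atTop_add_const_right _ (-(2 * l)) tendsto_id)
    exact ((tendsto_recPoch hq).comp hshift).mul_const _
  · refine Eventually.of_forall fun n y => ?_
    rw [norm_mul]
    exact mul_le_mul_of_nonneg_right (hB _) (norm_nonneg _)

theorem summable_norm_levelDelta (hq0 : q ≠ 0) (hq : ‖q‖ < 1) (d : ℕ) :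
    Summable fun r => ‖levelDelta q d r‖ := by
  obtain ⟨G, hG⟩ := exists_norm_gaussKernel_le hq
  have hw := (summable_norm_transferWeight hq0 hq hG d).prod_symm
  exact hw.prod.of_nonneg_of_le (fun _ => norm_nonneg _) fun r =>
    norm_tsum_le_tsum_norm (hw.prod_factor r)

theorem isConjugateBaileyPair_level (hq0 : q ≠ 0) (hq : ‖q‖ < 1) (d : ℕ) :
    IsConjugateBaileyPair q (levelDelta q d) (levelGamma q d) := by
  intro l
  obtain ⟨B, hB⟩ := exists_norm_recPoch_mul_recPoch_le hq
  obtain ⟨G, hG⟩ := exists_norm_gaussKernel_le hq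
  have hw := summable_norm_transferWeight hq0 hq hG d
  have hsum : Summable fun p : ℤ × ℤ => transferWeight q (gaussKernel q) d p.2 p.1 *
      (recPoch q (p.1 - l) * recPoch q (p.1 + l)) := by
    refine (hw.prod_symm.mul_right B).of_norm_bounded fun p => ?_
    rw [norm_mul]
    exact mul_le_mul_of_nonneg_left (hB _ _) (norm_nonneg _)
  refine (tendsto_nhds_unique (tendsto_finiteGamma_levelGamma hq0 hq d l)
    (tendsto_finiteGamma hq0 hq d l)).trans ?_
  simp only [levelDelta, mul_comm (recPoch q (_ + l)), ← tsum_mul_right]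
  rw [← hsum.tsum_prod, ← (Equiv.prodComm ℤ ℤ).tsum_eq]
  rfl

/-! ### Bailey pairs and the Bailey chain of the unit pair -/

/-- `(α, β)` is a Bailey pair relative to `a = 1`. The sequence `α` is indexed by all integers: its
entries at `j` and `-j` together form the classical `α_|j|`. -/
def IsBaileyPair (q : ℂ) (α β : ℤ → ℂ) : Prop :=
  ∀ r, β r = ∑' j, α j * (recPoch q (r - j) * recPoch q (r + j))

theorem hasSum_zpow_sq_mul_recPoch (hq0 : q ≠ 0) (hq : ‖q‖ < 1) (r j : ℤ) :
    HasSum (fun s : ℤ => q ^ s ^ 2 * recPoch q (r - s) * (recPoch q (s - j) * recPoch q (s + j)))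
      (q ^ j ^ 2 * (recPoch q (r - j) * recPoch q (r + j))) := by
  have hsum := ((hasSum_chuVandermondeTerm hq0 hq (r + j) (2 * j)).mul_right
    (recPoch q (r + j))).mul_left (q ^ j ^ 2)
  rw [show r + j - 2 * j = r - j by ring] at hsum
  refine ((Equiv.subRight j).hasSum_iff.mpr hsum).congr_fun fun s => ?_
  have hgauss := gauss_mul_recPoch hq (r + j) (s + j)
  rw [add_sub_add_right_eq_sub] at hgauss
  have hpow : q ^ s ^ 2 = q ^ j ^ 2 * q ^ ((s - j) * (s + j)) := by
    rw [← zpow_add₀ hq0]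
    ring_nf
  simp only [Function.comp_apply, Equiv.subRight_apply, chuVandermondeTerm,
    show s - j + 2 * j = s + j by ring]
  linear_combination (recPoch q (r - s) * recPoch q (s - j) * recPoch q (s + j)) * hpow -
    (q ^ j ^ 2 * q ^ ((s - j) * (s + j)) * recPoch q (s - j)) * hgauss

theorem IsBaileyPair.next {α β : ℤ → ℂ} (h : IsBaileyPair q α β) (hα : Summable fun j => ‖α j‖)
    (hq0 : q ≠ 0) (hq : ‖q‖ < 1) :
    IsBaileyPair q (fun j => q ^ j ^ 2 * α j)
      (fun r => ∑' s, q ^ s ^ 2 * recPoch q (r - s) * β s) := by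
  intro r
  obtain ⟨B, hB⟩ := exists_norm_recPoch_le hq
  obtain ⟨B', hB'⟩ := exists_norm_recPoch_mul_recPoch_le hq
  have hB0 : 0 ≤ B := (norm_nonneg _).trans (hB 0)
  have hsum : Summable (Function.uncurry fun (s j : ℤ) => α j *
      (q ^ s ^ 2 * recPoch q (r - s) * (recPoch q (s - j) * recPoch q (s + j)))) := by
    refine (((summable_zpow_sq (norm_pos_iff.mpr hq0) hq).mul_of_nonneg hα
      (fun _ => by positivity) fun _ => norm_nonneg _).mul_right (B * B')).of_norm_bounded
      fun ⟨s, j⟩ => ?_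
    calc _ = ‖α j‖ * (‖q‖ ^ s ^ 2 * ‖recPoch q (r - s)‖ *
          ‖recPoch q (s - j) * recPoch q (s + j)‖) := by
          simp only [Function.uncurry_apply_pair, norm_mul, norm_zpow]
      _ ≤ ‖α j‖ * (‖q‖ ^ s ^ 2 * B * B') := by
          gcongr
          exacts [hB _, hB' _ _]
      _ = _ := by ring
  calc ∑' s, q ^ s ^ 2 * recPoch q (r - s) * β s
      = ∑' (s : ℤ) (j : ℤ), α j *
          (q ^ s ^ 2 * recPoch q (r - s) * (recPoch q (s - j) * recPoch q (s + j))) := by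
        simp only [h _, ← tsum_mul_left]
        exact tsum_congr fun s => tsum_congr fun j => by ring
    _ = ∑' (j : ℤ) (s : ℤ), α j *
          (q ^ s ^ 2 * recPoch q (r - s) * (recPoch q (s - j) * recPoch q (s + j))) :=
        hsum.tsum_comm.symm
    _ = _ := by
        refine tsum_congr fun j => ?_
        rw [((hasSum_zpow_sq_mul_recPoch hq0 hq r j).mul_left (α j)).tsum_eq]
        ring

theorem IsBaileyPair.tsum_mul_eq {α β γ δ : ℤ → ℂ} (h : IsBaileyPair q α β)
    (h' : IsConjugateBaileyPair q δ γ) (hα : Summable fun j => ‖α j‖)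
    (hδ : Summable fun r => ‖δ r‖) (hq : ‖q‖ < 1) : ∑' r, δ r * β r = ∑' j, α j * γ j := by
  obtain ⟨B, hB⟩ := exists_norm_recPoch_mul_recPoch_le hq
  have hsum : Summable (Function.uncurry fun (r j : ℤ) =>
      δ r * (α j * (recPoch q (r - j) * recPoch q (r + j)))) := by
    refine ((hδ.mul_of_nonneg hα (fun _ => norm_nonneg _) fun _ => norm_nonneg _).mul_right
      B).of_norm_bounded fun ⟨r, j⟩ => ?_
    rw [Function.uncurry_apply_pair, norm_mul, norm_mul, ← mul_assoc]
    exact mul_le_mul_of_nonneg_left (hB _ _) (by positivity)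
  simp only [h _, h' _, ← tsum_mul_left]
  rw [← hsum.tsum_comm]
  exact tsum_congr fun j => tsum_congr fun r => mul_left_comm _ _ _

/-- The sequence `α` of the `k`-th Bailey pair in the chain starting from the unit pair. -/
def chainAlpha (q : ℂ) (k : ℕ) (j : ℤ) : ℂ := (-1) ^ j * q ^ (tri (j + 1) + k * j ^ 2)

/-- The sequence `β` of the `k`-th Bailey pair in the chain starting from the unit pair. -/
def chainBeta (q : ℂ) : ℕ → ℤ → ℂ
  | 0, r => if r = 0 then 1 else 0
  | k + 1, r => ∑' s : ℤ, q ^ s ^ 2 * recPoch q (r - s) * chainBeta q k s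

theorem summable_norm_chainAlpha (hq0 : q ≠ 0) (hq : ‖q‖ < 1) (k : ℕ) :
    Summable fun j => ‖chainAlpha q k j‖ := by
  have hρ : 0 < ‖q‖ := norm_pos_iff.mpr hq0
  refine ((summable_zpow_abs hρ.le hq).mul_left (‖q‖ ^ (-9 : ℤ))).of_nonneg_of_le
    (fun _ => norm_nonneg _) fun j => ?_
  have hbound := mul_abs_sub_sq_le 2 1 j
  have hk : 0 ≤ (k : ℤ) * j ^ 2 := by positivity
  have htri := two_mul_tri (j + 1)
  rw [chainAlpha, norm_mul, norm_zpow, norm_neg, norm_one, one_zpow, one_mul, norm_zpow]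
  refine zpow_le_of_abs_sub_le hρ hq ?_
  rw [abs_one] at hbound
  linarith

theorem chainAlpha_zero_sub_one (hq0 : q ≠ 0) (r j : ℤ) :
    q ^ r * chainAlpha q 0 (j - 1) = -(q ^ (r - j) * chainAlpha q 0 j) := by
  simp only [chainAlpha, Nat.cast_zero, zero_mul, add_zero, sub_add_cancel, tri_add_one]
  rw [zpow_sub_one₀ (by norm_num), zpow_sub₀ hq0, zpow_add₀ hq0]
  field_simp [zpow_ne_zero j hq0]

/- The substitution `j ↦ -1 - j` changes the sign of each term. -/
theorem tsum_chainAlpha_zero_mul_eq_zero (q : ℂ) (r : ℤ) :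
    ∑' j : ℤ, chainAlpha q 0 j * (recPoch q (r - 1 - j) * recPoch q (r + j)) = 0 := by
  have hα (j : ℤ) : chainAlpha q 0 (-1 - j) = -chainAlpha q 0 j := by
    have htri : tri (-1 - j + 1) = tri (j + 1) := by
      linarith [two_mul_tri (-1 - j + 1), two_mul_tri (j + 1)]
    simp only [chainAlpha, htri, Nat.cast_zero, zero_mul]
    rw [zpow_sub₀ (by norm_num), zpow_neg_one]
    rcases Int.even_or_odd j with hj | hj <;> rw [hj.neg_one_zpow] <;> norm_num
  refine self_eq_neg.mp ?_
  conv_lhs => rw [← (Equiv.subLeft (-1 : ℤ)).tsum_eq]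
  rw [← tsum_neg]
  refine tsum_congr fun j => ?_
  rw [Equiv.subLeft_apply, hα, show r - 1 - (-1 - j) = r + j by ring,
    show r + (-1 - j) = r - 1 - j by ring]
  ring

theorem one_sub_zpow_mul_unitBaileyTerm (hq0 : q ≠ 0) (hq : ‖q‖ < 1) (r j : ℤ) :
    (1 - q ^ (2 * r)) * (chainAlpha q 0 j * (recPoch q (r - j) * recPoch q (r + j))) =
      chainAlpha q 0 j * (recPoch q (r - 1 - j) * recPoch q (r + j)) +
        -q ^ r * (chainAlpha q 0 (j - 1) *
          (recPoch q (r - 1 - (j - 1)) * recPoch q (r + (j - 1)))) := by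
  have hminus := recPoch_mul_one_sub hq (r - j)
  have hplus := recPoch_mul_one_sub hq (r + j)
  have hα := chainAlpha_zero_sub_one hq0 r j
  have hpow : q ^ (2 * r) = q ^ (r - j) * q ^ (r + j) := by
    rw [← zpow_add₀ hq0]
    ring_nf
  rw [sub_sub_sub_cancel_right, sub_right_comm r 1 j, ← add_sub_assoc, ← hminus, ← hplus, hpow]
  linear_combination (recPoch q (r - j) * recPoch q (r + j) * (1 - q ^ (r + j))) * hα

theorem tsum_unitBaileyTerm_of_pos (hq0 : q ≠ 0) (hq : ‖q‖ < 1) {r : ℤ} (hr : 0 < r) :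
    ∑' j : ℤ, chainAlpha q 0 j * (recPoch q (r - j) * recPoch q (r + j)) = 0 := by
  obtain ⟨B, hB⟩ := exists_norm_recPoch_mul_recPoch_le hq
  have hsum : HasSum (fun j : ℤ => chainAlpha q 0 j * (recPoch q (r - 1 - j) * recPoch q (r + j)))
      0 := by
    rw [← tsum_chainAlpha_zero_mul_eq_zero q r]
    refine (((summable_norm_chainAlpha hq0 hq 0).mul_right B).of_norm_bounded fun j => ?_).hasSum
    rw [norm_mul]
    exact mul_le_mul_of_nonneg_left (hB _ _) (norm_nonneg _)
  have hshift := ((Equiv.subRight (1 : ℤ)).hasSum_iff.mpr hsum).mul_left (-q ^ r)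
  have hne : 1 - q ^ (2 * r) ≠ 0 := by
    obtain ⟨m, hm⟩ : ∃ m : ℕ, 2 * r = ((m + 1 : ℕ) : ℤ) := ⟨(2 * r - 1).toNat, by omega⟩
    rw [hm, zpow_natCast]
    exact one_sub_pow_succ_ne_zero hq m
  refine (mul_eq_zero.mp ?_).resolve_left hne
  rw [← tsum_mul_left, tsum_congr (one_sub_zpow_mul_unitBaileyTerm hq0 hq r)]
  simpa using (hsum.add hshift).tsum_eq

theorem recPoch_sub_mul_recPoch_add_of_lt_abs (q : ℂ) {r j : ℤ} (h : r < |j|) :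
    recPoch q (r - j) * recPoch q (r + j) = 0 := by
  rcases lt_abs.mp h with h | h
  · rw [recPoch_of_neg q (by omega : r - j < 0), zero_mul]
  · rw [recPoch_of_neg q (by omega : r + j < 0), mul_zero]

theorem isBaileyPair_unit (hq0 : q ≠ 0) (hq : ‖q‖ < 1) :
    IsBaileyPair q (chainAlpha q 0) (chainBeta q 0) := by
  intro r
  rw [chainBeta]
  rcases lt_trichotomy r 0 with hr | rfl | hr
  · have hzero (j : ℤ) := recPoch_sub_mul_recPoch_add_of_lt_abs q (hr.trans_le (abs_nonneg j))
    simp only [if_neg hr.ne, hzero, mul_zero, tsum_zero]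
  · rw [if_pos rfl, tsum_eq_single 0 fun j hj => ?_]
    · simp [chainAlpha, tri]
    · rw [recPoch_sub_mul_recPoch_add_of_lt_abs q (abs_pos.mpr hj), mul_zero]
  · rw [if_neg hr.ne', tsum_unitBaileyTerm_of_pos hq0 hq hr]

theorem isBaileyPair_chain (hq0 : q ≠ 0) (hq : ‖q‖ < 1) (k : ℕ) :
    IsBaileyPair q (chainAlpha q k) (chainBeta q k) := by
  induction k with
  | zero => exact isBaileyPair_unit hq0 hq
  | succ k ih =>
    have hα (j : ℤ) : chainAlpha q (k + 1) j = q ^ j ^ 2 * chainAlpha q k j := by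
      rw [chainAlpha, chainAlpha, mul_left_comm, ← zpow_add₀ hq0]
      push_cast
      ring_nf
    rw [funext hα]
    exact ih.next (summable_norm_chainAlpha hq0 hq k) hq0 hq

theorem chainBeta_of_neg (q : ℂ) (k : ℕ) {r : ℤ} (hr : r < 0) : chainBeta q k r = 0 := by
  induction k generalizing r with
  | zero => exact if_neg hr.ne
  | succ k ih =>
    refine (tsum_congr fun s => ?_).trans tsum_zero
    rcases lt_or_ge s 0 with hs | hs
    · rw [ih hs, mul_zero]
    · rw [recPoch_of_neg q (by omega : r - s < 0), mul_zero, zero_mul]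

theorem tsum_natCast_of_forall_neg {M : Type*} [AddCommMonoid M] [TopologicalSpace M] {f : ℤ → M}
    (hf : ∀ r < 0, f r = 0) : ∑' r : ℕ, f r = ∑' r : ℤ, f r :=
  Nat.cast_injective.tsum_eq fun r hr => by
    have hr0 : 0 ≤ r := le_of_not_gt fun h => hr (hf r h)
    exact ⟨r.toNat, Int.toNat_of_nonneg hr0⟩

theorem tsum_levelDelta_mul_chainBeta (hq0 : q ≠ 0) (hq : ‖q‖ < 1) (d k : ℕ) :
    ∑' r : ℕ, levelDelta q d r * chainBeta q k r = ∑' j, chainAlpha q k j * levelGamma q d j := by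
  rw [tsum_natCast_of_forall_neg (f := fun r => levelDelta q d r * chainBeta q k r)
    fun r hr => by rw [chainBeta_of_neg q k hr, mul_zero]]
  exact (isBaileyPair_chain hq0 hq k).tsum_mul_eq (isConjugateBaileyPair_level hq0 hq d)
    (summable_norm_chainAlpha hq0 hq k) (summable_norm_levelDelta hq0 hq d) hq

/-- The weight of a sequence `x ≥ r_1 ≥ … ≥ r_k ≥ 0` in the unrolled Bailey chain; it vanishes if
the sequence is not decreasing. -/
def chainWeight (q : ℂ) : (k : ℕ) → ℤ → (Fin k → ℕ) → ℂ
  | 0, x, _ => recPoch q x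
  | k + 1, x, r => q ^ (r 0 : ℤ) ^ 2 * recPoch q (x - r 0) * chainWeight q k (r 0) (Fin.tail r)

theorem exists_norm_chainWeight_le (hq0 : q ≠ 0) (hq : ‖q‖ < 1) (k : ℕ) :
    ∃ g : (Fin k → ℕ) → ℝ, Summable g ∧ ∀ x r, ‖chainWeight q k x r‖ ≤ g r := by
  obtain ⟨B, hB⟩ := exists_norm_recPoch_le hq
  have hB0 : 0 ≤ B := (norm_nonneg _).trans (hB 0)
  induction k with
  | zero => exact ⟨fun _ => B, (hasSum_fintype _).summable, fun x _ => hB x⟩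
  | succ k ih =>
    obtain ⟨g, hg, hgb⟩ := ih
    have hsq : Summable fun s : ℕ => ‖q‖ ^ (s : ℤ) ^ 2 * B :=
      ((summable_zpow_sq (norm_pos_iff.mpr hq0) hq).comp_injective Nat.cast_injective).mul_right B
    refine ⟨fun r => ‖q‖ ^ (r 0 : ℤ) ^ 2 * B * g (Fin.tail r), ?_, fun x r => ?_⟩
    · refine (Fin.consEquiv fun _ => ℕ).summable_iff.mp ((hsq.mul_of_nonneg hg
        (fun _ => by positivity) fun r => (norm_nonneg _).trans (hgb 0 r)).congr ?_)
      rintro ⟨s, r⟩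
      simp [Fin.consEquiv]
    · rw [chainWeight, norm_mul, norm_mul, norm_zpow]
      exact mul_le_mul (mul_le_mul_of_nonneg_left (hB _) (by positivity)) (hgb _ _)
        (norm_nonneg _) (by positivity)

theorem tsum_chainWeight (hq0 : q ≠ 0) (hq : ‖q‖ < 1) (k : ℕ) (x : ℤ) :
    ∑' r, chainWeight q k x r = chainBeta q (k + 1) x := by
  induction k generalizing x with
  | zero =>
    rw [tsum_eq_single (default : Fin 0 → ℕ) fun r hr => (hr (Subsingleton.elim _ _)).elim,
      chainBeta, tsum_eq_single 0 fun s hs => by simp [chainBeta, hs]]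
    simp [chainWeight, chainBeta]
  | succ k ih =>
    obtain ⟨g, hg, hgb⟩ := exists_norm_chainWeight_le hq0 hq (k + 1)
    let e : ℕ × (Fin k → ℕ) ≃ (Fin (k + 1) → ℕ) := Fin.consEquiv fun _ => ℕ
    have hsum := e.summable_iff.mpr (hg.of_norm_bounded (hgb x))
    rw [← e.tsum_eq, chainBeta, ← tsum_natCast_of_forall_neg fun r hr => by
      rw [chainBeta_of_neg q _ hr, mul_zero]]
    refine hsum.tsum_prod.trans (tsum_congr fun s => ?_)
    rw [← ih, ← tsum_mul_left]
    rfl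

theorem chainWeight_eq_prod (hq0 : q ≠ 0) (k : ℕ) (r : Fin (k + 1) → ℕ) (p : ℕ → ℕ)
    (hp : ∀ i : Fin (k + 1), p i = r i) (hp' : p (k + 1) = 0) :
    chainWeight q k (r 0) (Fin.tail r) =
      q ^ (∑ i ∈ Finset.range k, (p (i + 1) : ℤ) ^ 2) *
        ∏ i ∈ Finset.range (k + 1), recPoch q ((p i : ℤ) - p (i + 1)) := by
  induction k generalizing p with
  | zero => simp [chainWeight, hp', ← hp 0]
  | succ k ih =>
    have htail := ih (Fin.tail r) (fun i => p (i + 1)) (fun i => hp i.succ) hp'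
    have h0 : p 0 = r 0 := hp 0
    have h1 : p 1 = Fin.tail r 0 := hp 1
    rw [chainWeight, htail, Finset.prod_range_succ' _ (k + 1), Finset.sum_range_succ',
      zpow_add₀ hq0, ← h1, ← h0, zero_add]
    ring

/-! ### The inverse Cartan matrix and convex integer paths -/

/-- The second difference of a sequence. Second differences of integer paths parametrize the
vectors `η` and `n` of the two inner sums. -/
def secondDiff {R : Type*} [CommRing R] (K : ℕ → R) (i : ℕ) : R := K i - 2 * K (i + 1) + K (i + 2)

theorem sum_range_secondDiff_mul {R : Type*} [CommRing R] (K u : ℕ → R) (d : ℕ) :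
    ∑ i ∈ Finset.range d, secondDiff K i * u (i + 1) =
      (K (d + 1) - K d) * u (d + 1) - (K 1 - K 0) * u 0 -
        ∑ i ∈ Finset.range (d + 1), (K (i + 1) - K i) * (u (i + 1) - u i) := by
  induction d with
  | zero => simp only [Finset.sum_range_zero, Finset.sum_range_one, zero_add]; ring
  | succ d ih =>
    rw [Finset.sum_range_succ, ih, Finset.sum_range_succ _ (d + 1), secondDiff]
    ring

theorem secondDiff_intCast {R : Type*} [CommRing R] (K : ℕ → ℤ) (i : ℕ) :
    secondDiff (fun i => (K i : R)) i = ((secondDiff K i : ℤ) : R) := by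
  simp only [secondDiff]
  push_cast
  rfl

theorem eq_of_secondDiff_eq {R : Type*} [CommRing R] [NoZeroDivisors R] [CharZero R] {K K' : ℕ → R}
    {d : ℕ} (hfirst : K 0 = K' 0) (hlast : K (d + 1) = K' (d + 1))
    (h : ∀ i < d, secondDiff K i = secondDiff K' i) {i : ℕ} (hi : i ≤ d + 1) : K i = K' i := by
  have hlinear : ∀ i ≤ d + 1, K i - K' i = i * (K 1 - K' 1) := by
    intro i
    induction i using Nat.twoStepInduction with
    | zero => simp [hfirst]
    | one => simp
    | more i ih₀ ih₁ =>
      intro hi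
      have h₂ := h i (by omega)
      have h₀ := ih₀ (by omega)
      have h₁ := ih₁ (by omega)
      simp only [secondDiff] at h₂
      push_cast at h₁ ⊢
      linear_combination h₂ + 2 * h₁ - h₀
  have hslope : K 1 - K' 1 = 0 := by
    have := hlinear (d + 1) le_rfl
    rw [hlast, sub_self, eq_comm, mul_eq_zero] at this
    exact this.resolve_left (Nat.cast_ne_zero.mpr d.succ_ne_zero)
  exact sub_eq_zero.mp (by rw [hlinear i hi, hslope, mul_zero])

section Cartan

open Matrix

theorem incidence_mulVec_add_smul_unitVec (N : ℕ) {f : ℕ → ℚ} (h0 : f 0 = 0) :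
    (incidence N *ᵥ fun j => f (j + 1)) + f N • unitVec N (N - 1) =
      fun i : Fin (N - 1) => f i + f (i + 2) := by
  ext ⟨i, hi⟩
  have hleft : ∑ j ∈ Finset.range (N - 1), (if i = j + 1 then f (j + 1) else 0) = f i := by
    rcases i with _ | i
    · exact (Finset.sum_eq_zero fun j _ => if_neg (by omega)).trans h0.symm
    · simp only [add_left_inj, Finset.sum_ite_eq]
      exact if_pos (Finset.mem_range.mpr (by omega))
  have hright : ∑ j ∈ Finset.range (N - 1), (if i + 1 = j then f (j + 1) else 0) +
      f N * (if i + 1 = N - 1 then 1 else 0) = f (i + 2) := by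
    rw [Finset.sum_ite_eq]
    rcases (show i + 2 ≤ N by omega).lt_or_eq with hN | rfl
    · rw [if_pos (Finset.mem_range.mpr (by omega)), if_neg (by omega), mul_zero, add_zero]
    · simp
  simp only [Pi.add_apply, Pi.smul_apply, smul_eq_mul, mulVec, dotProduct, incidence, of_apply,
    unitVec]
  rw [Fin.sum_univ_eq_sum_range (fun j => ((if i + 1 = j then (1 : ℚ) else 0) +
    (if i = j + 1 then 1 else 0)) * f (j + 1)) (N - 1)]
  simp only [add_mul, ite_mul, one_mul, zero_mul, Finset.sum_add_distrib]
  rw [hleft, add_right_comm, hright, add_comm]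

theorem cartan_mulVec {N : ℕ} {f : ℕ → ℚ} (h0 : f 0 = 0) (hN : f N = 0) :
    (cartan N *ᵥ fun j => f (j + 1)) = fun i : Fin (N - 1) => -secondDiff f i := by
  have h := incidence_mulVec_add_smul_unitVec N h0
  rw [hN, zero_smul, add_zero] at h
  rw [cartan_eq, sub_mulVec, h, smul_mulVec, one_mulVec]
  ext i
  simp only [Pi.sub_apply, Pi.smul_apply, smul_eq_mul, secondDiff]
  ring

/- The inverse has the entries `min i j - i j / N`, where `i` and `j` are labels starting at `1`. -/
theorem isUnit_det_cartan (N : ℕ) : IsUnit (cartan N).det := by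
  let green (j a : ℕ) : ℚ := min (a : ℚ) (j + 1) - a * (j + 1) / N
  refine isUnit_det_of_right_inverse
    (B := of fun i j : Fin (N - 1) => green j (i + 1)) ?_
  ext i j
  have hN : (N : ℚ) ≠ 0 := Nat.cast_ne_zero.mpr (by have := i.2; omega)
  have hj : ((j : ℕ) : ℚ) + 1 ≤ N := by exact_mod_cast (by have := j.2; omega : (j : ℕ) + 1 ≤ N)
  have hzero : green j 0 = 0 := by
    simp only [green, Nat.cast_zero, zero_mul, zero_div, sub_zero]
    exact min_eq_left (by positivity)
  have hlast : green j N = 0 := by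
    simp only [green, min_eq_right hj]
    field_simp
    ring
  refine (congrFun (cartan_mulVec hzero hlast) i).trans ?_
  simp only [secondDiff, green, one_apply, Fin.ext_iff]
  push_cast
  rcases lt_trichotomy (i : ℕ) j with hij | hij | hij
  · have : ((i : ℕ) : ℚ) + 1 ≤ (j : ℕ) := by exact_mod_cast hij
    rw [if_neg hij.ne, min_eq_left (by linarith), min_eq_left (by linarith),
      min_eq_left (by linarith)]
    ring
  · rw [if_pos hij, hij, min_eq_left (by linarith), min_eq_left le_rfl,
      min_eq_right (by linarith)]
    ring
  · have : ((j : ℕ) : ℚ) + 1 ≤ (i : ℕ) := by exact_mod_cast hij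
    rw [if_neg hij.ne', min_eq_right (by linarith), min_eq_right (by linarith),
      min_eq_right (by linarith)]
    ring

theorem cartan_inv_mulVec_secondDiff {N : ℕ} [NeZero N] {K : ℕ → ℚ} (h0 : K 0 = 0) :
    ((cartan N)⁻¹ *ᵥ fun i : Fin (N - 1) => secondDiff K i) =
      fun i : Fin (N - 1) => ((i : ℕ) + 1 : ℕ) * (K N / N) - K (i + 1) := by
  have hN : (N : ℚ) ≠ 0 := NeZero.ne _
  have h := cartan_mulVec (N := N) (f := fun a => a * (K N / N) - K a) (by simp [h0])
    (by field_simp; ring)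
  have hsecondDiff : (fun i : Fin (N - 1) => secondDiff K i) =
      cartan N *ᵥ fun i : Fin (N - 1) => ((i : ℕ) + 1 : ℕ) * (K N / N) - K (i + 1) := by
    rw [h]
    ext i
    simp only [secondDiff]
    push_cast
    ring
  rw [hsecondDiff, mulVec_mulVec, nonsing_inv_mul _ (isUnit_det_cartan N), one_mulVec]

theorem quadForm_eq_sum_sq_sub {N : ℕ} [NeZero N] {K : ℕ → ℚ} (h0 : K 0 = 0)
    {v : Fin (N - 1) → ℕ} (hv : toRat v = fun i : Fin (N - 1) => secondDiff K i) :
    quadForm N v = ∑ i ∈ Finset.range N, (K (i + 1) - K i) ^ 2 - K N ^ 2 / N := by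
  have hN : (N : ℚ) ≠ 0 := NeZero.ne _
  have hsummand (i : ℕ) : (K (i + 1) - K i) *
      ((i + 1 : ℕ) * (K N / N) - K (i + 1) - (i * (K N / N) - K i)) =
        K N / N * (K (i + 1) - K i) - (K (i + 1) - K i) ^ 2 := by
    push_cast
    ring
  rw [quadForm, hv, cartan_inv_mulVec_secondDiff h0, dotProduct,
    Fin.sum_univ_eq_sum_range (fun i => secondDiff K i *
      ((i + 1 : ℕ) * (K N / N) - K (i + 1))) (N - 1),
    sum_range_secondDiff_mul K fun a => a * (K N / N) - K a, Nat.sub_add_cancel NeZero.one_le]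
  simp only [hsummand]
  rw [Finset.sum_sub_distrib, ← Finset.mul_sum, Finset.sum_range_sub, h0]
  field_simp
  push_cast
  ring

theorem unitVec_one_dotProduct_cartan_inv_mulVec {N : ℕ} [NeZero N] {K : ℕ → ℚ} (h0 : K 0 = 0) :
    (unitVec N 1 ⬝ᵥ (cartan N)⁻¹ *ᵥ fun i : Fin (N - 1) => secondDiff K i) = K N / N - K 1 := by
  rw [cartan_inv_mulVec_secondDiff h0, dotProduct]
  rcases (NeZero.one_le : 1 ≤ N).lt_or_eq with h | rfl
  · rw [Finset.sum_eq_single (⟨0, by omega⟩ : Fin (N - 1)) (fun i _ hi => ?_) (by simp)]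
    · simp [unitVec]
    · rw [unitVec, if_neg fun hi' => hi (Fin.ext (by simpa using hi')), zero_mul]
  · simp

theorem mnSystem_iff {N L : ℕ} [NeZero N] {m n : Fin (N - 1) → ℕ} :
    MNSystem N L m n ↔ ∀ i : Fin (N - 1),
      secondDiff (pathExt (fun j => (m j : ℤ)) (2 * L)) i = 2 * n i := by
  let M (i : ℕ) : ℚ := pathExt (fun j => (m j : ℤ)) (2 * L) i
  have hM (i : Fin (N - 1)) : M (i + 1) = m i := by simp [M, pathExt_succ _ _ i.2]
  have hN : M N = 2 * L := by
    have := pathExt_last (fun j => (m j : ℤ)) (2 * L)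
    rw [Nat.sub_add_cancel NeZero.one_le] at this
    simp [M, this]
  have h := incidence_mulVec_add_smul_unitVec N (f := M) (by simp [M])
  rw [hN, show (fun j : Fin (N - 1) => M (j + 1)) = toRat m from funext hM] at h
  rw [MNSystem, h, funext_iff]
  refine forall_congr' fun i => ?_
  rw [← Int.cast_inj (α := ℚ), ← secondDiff_intCast]
  change (m i : ℚ) + n i = 1 / 2 * (M i + M (i + 2)) ↔ M i - 2 * M (i + 1) + M (i + 2) = _
  rw [hM]
  push_cast
  constructor <;> intro <;> linarith

end Cartan

/-- The interior vertices `K_1, …, K_d` of the convex integer paths `0, K_1, …, K_d, L`. -/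
def convexPaths (d : ℕ) (L : ℤ) : Set (Fin d → ℤ) :=
  {K | ∀ i : Fin d, 0 ≤ secondDiff (pathExt K L) i}

/-- The second differences of a path `0, K_1, …, K_d, L`, meant for a convex path: a negative
second difference is replaced by `0`. -/
def diffVec {d : ℕ} (K : Fin d → ℤ) (L : ℤ) (i : Fin d) : ℕ := (secondDiff (pathExt K L) i).toNat

theorem natCast_diffVec {d : ℕ} {L : ℤ} {K : Fin d → ℤ} (hK : K ∈ convexPaths d L) (i : Fin d) :
    (diffVec K L i : ℤ) = secondDiff (pathExt K L) i :=
  Int.toNat_of_nonneg (hK i)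

theorem toRat_diffVec {d : ℕ} {L : ℤ} {K : Fin d → ℤ} (hK : K ∈ convexPaths d L) :
    toRat (diffVec K L) = fun i : Fin d => secondDiff (fun i => (pathExt K L i : ℚ)) i := by
  ext i
  rw [secondDiff_intCast, ← natCast_diffVec hK, Int.cast_natCast, toRat]

theorem pathExt_injective {d : ℕ} {K K' : Fin d → ℤ} {L : ℤ}
    (h : ∀ i < d, secondDiff (pathExt K L) i = secondDiff (pathExt K' L) i) : K = K' := by
  ext i
  have hlt := i.2
  have := eq_of_secondDiff_eq (K := pathExt K L) (K' := pathExt K' L) (by simp) (by simp) h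
    (i := i + 1) (by omega)
  rwa [pathExt_succ _ _ i.2, pathExt_succ _ _ i.2] at this

theorem diffVec_injOn (d : ℕ) (L : ℤ) : Set.InjOn (fun K => diffVec K L) (convexPaths d L) :=
  fun K hK K' hK' h => pathExt_injective fun i hi => by
    rw [← natCast_diffVec hK ⟨i, hi⟩, ← natCast_diffVec hK' ⟨i, hi⟩]
    exact congrArg Nat.cast (congrFun h ⟨i, hi⟩)

theorem pathExt_eq_last {N : ℕ} [NeZero N] (K : Fin (N - 1) → ℤ) (L : ℤ) : pathExt K L N = L := by
  have := pathExt_last K L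
  rwa [Nat.sub_add_cancel NeZero.one_le] at this

theorem integralShift_diffVec {N : ℕ} [NeZero N] {L : ℤ} {K : Fin (N - 1) → ℤ}
    (hK : K ∈ convexPaths (N - 1) L) : IntegralShift N L (diffVec K L) := by
  refine ⟨pathExt K L 1, ?_⟩
  rw [toRat_diffVec hK, unitVec_one_dotProduct_cartan_inv_mulVec (by simp), pathExt_eq_last]
  ring

theorem quadForm_diffVec {N : ℕ} [NeZero N] {L : ℤ} {K : Fin (N - 1) → ℤ}
    (hK : K ∈ convexPaths (N - 1) L) : (L : ℚ) ^ 2 / N + quadForm N (diffVec K L) =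
      ((∑ i ∈ Finset.range N, (pathExt K L (i + 1) - pathExt K L i) ^ 2 : ℤ) : ℚ) := by
  rw [quadForm_eq_sum_sq_sub (by simp) (toRat_diffVec hK), pathExt_eq_last]
  push_cast
  ring

/-- The sequence with initial values `0`, `z` and second differences `v`. -/
def secondSum (z : ℤ) (v : ℕ → ℤ) : ℕ → ℤ
  | 0 => 0
  | 1 => z
  | n + 2 => v n + 2 * secondSum z v (n + 1) - secondSum z v n

theorem secondDiff_secondSum (z : ℤ) (v : ℕ → ℤ) : secondDiff (secondSum z v) = v := by
  ext i
  rw [secondDiff, secondSum.eq_3]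
  ring

theorem pathExt_comp_succ {d : ℕ} {S : ℕ → ℤ} (h0 : S 0 = 0) {i : ℕ} (hi : i ≤ d + 1) :
    pathExt (fun i : Fin d => S (i + 1)) (S (d + 1)) i = S i := by
  rcases i with _ | i
  · rw [pathExt_zero, h0]
  rcases (Nat.le_of_succ_le_succ hi).lt_or_eq with h | rfl
  · rw [pathExt_succ _ _ h]
  · rw [pathExt_last]

theorem exists_secondDiff_pathExt_eq {N : ℕ} [NeZero N] {L : ℤ} {v : Fin (N - 1) → ℕ}
    (hv : IntegralShift N L v) :
    ∃ K : Fin (N - 1) → ℤ, ∀ i : Fin (N - 1), secondDiff (pathExt K L) i = v i := by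
  obtain ⟨z, hz⟩ := hv
  let S := secondSum z fun i => if h : i < N - 1 then (v ⟨i, h⟩ : ℤ) else 0
  have hS (i : Fin (N - 1)) : secondDiff S i = v i := by
    rw [secondDiff_secondSum]
    exact dif_pos i.2
  have hrat : toRat v = fun i : Fin (N - 1) => secondDiff (fun i => (S i : ℚ)) i := by
    ext i
    rw [secondDiff_intCast, hS, Int.cast_natCast, toRat]
  have hlast : S (N - 1 + 1) = L := by
    have hS1 : S 1 = z := rfl
    rw [hrat, unitVec_one_dotProduct_cartan_inv_mulVec (by simp [S, secondSum]), hS1] at hz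
    have : (L : ℚ) / N = S N / N := by linarith
    rw [div_left_inj' (NeZero.ne _)] at this
    rw [Nat.sub_add_cancel NeZero.one_le]
    exact_mod_cast this.symm
  refine ⟨fun i => S (i + 1), fun i => ?_⟩
  have hi := i.2
  have hext {i : ℕ} (hi : i ≤ N - 1 + 1) := pathExt_comp_succ (S := S) rfl hi
  rw [← hlast, ← hS i, secondDiff, hext (by omega), hext (by omega), hext (by omega), secondDiff]

theorem exists_diffVec_eq {N : ℕ} [NeZero N] {L : ℤ} {v : Fin (N - 1) → ℕ}
    (hv : IntegralShift N L v) : ∃ K ∈ convexPaths (N - 1) L, diffVec K L = v := by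
  obtain ⟨K, hK⟩ := exists_secondDiff_pathExt_eq hv
  refine ⟨K, fun i => (hK i).symm ▸ Int.natCast_nonneg _, funext fun i => ?_⟩
  rw [diffVec, hK, Int.toNat_natCast]

/-- Convex paths from `0` to `L` with `N` steps correspond to the vectors `η`. -/
def etaEquiv (N : ℕ) [NeZero N] (L : ℤ) : convexPaths (N - 1) L ≃ EtaIndex N L :=
  Equiv.ofBijective (fun K => ⟨diffVec K.1 L, integralShift_diffVec K.2⟩) <| by
    constructor
    · intro K K' h
      exact Subtype.ext (diffVec_injOn _ L K.2 K'.2 (congrArg Subtype.val h))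
    · rintro ⟨v, hv⟩
      obtain ⟨K, hK, rfl⟩ := exists_diffVec_eq hv
      exact ⟨⟨K, hK⟩, rfl⟩

theorem secondDiff_pathExt_two_mul {d : ℕ} (K : Fin d → ℤ) (L : ℤ) (i : ℕ) :
    secondDiff (pathExt (fun j => 2 * K j) (2 * L)) i = 2 * secondDiff (pathExt K L) i := by
  have htwo (i : ℕ) : pathExt (fun j => 2 * K j) (2 * L) i = 2 * pathExt K L i := by
    simp only [pathExt]
    split_ifs <;> ring
  simp only [secondDiff, htwo]
  ring

theorem mnSystem_diffVec_iff {N L : ℕ} [NeZero N] {m : Fin (N - 1) → ℕ} {K : Fin (N - 1) → ℤ}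
    (hK : K ∈ convexPaths (N - 1) L) :
    MNSystem N L m (diffVec K L) ↔ ∀ i, (m i : ℤ) = 2 * K i := by
  simp only [mnSystem_iff, natCast_diffVec hK, ← secondDiff_pathExt_two_mul]
  constructor
  · intro h
    exact congrFun (pathExt_injective fun i hi => h ⟨i, hi⟩)
  · intro h i
    simp only [h]

/-- The convex integer paths `0, K_1, …, K_d, L` with nonnegative interior vertices. -/
def nonnegConvexPaths (d : ℕ) (L : ℤ) : Set (Fin d → ℤ) := {K | 0 ≤ K ∧ K ∈ convexPaths d L}

/-- Nonnegative convex paths `K` from `0` to `L` with `N` steps correspond to the solutions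
`(m, n)` of the `(m, n)`-system, with `m = 2 K`. -/
def mnEquiv (N : ℕ) [NeZero N] (L : ℕ) : nonnegConvexPaths (N - 1) L ≃ MNIndex N L :=
  Equiv.ofBijective (fun K => ⟨(fun i => (2 * K.1 i).toNat, diffVec K.1 L),
    integralShift_diffVec K.2.2, (mnSystem_diffVec_iff K.2.2).mpr fun i =>
      Int.toNat_of_nonneg (mul_nonneg zero_le_two (K.2.1 i))⟩) <| by
    constructor
    · intro K K' h
      exact Subtype.ext (diffVec_injOn _ _ K.2.2 K'.2.2 (congrArg (fun p => p.1.2) h))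
    · rintro ⟨⟨m, n⟩, hshift, hmn⟩
      obtain ⟨K, hK, rfl⟩ := exists_diffVec_eq hshift
      have hm := (mnSystem_diffVec_iff hK).mp hmn
      refine ⟨⟨K, fun i => show 0 ≤ K i by have := hm i; omega, hK⟩,
        Subtype.ext (Prod.ext (funext fun i => ?_) rfl)⟩
      simp only [← hm i, Int.toNat_natCast]

/-! ### The two sides in terms of path and chain weights -/

theorem qPow_add (hq0 : q ≠ 0) (x y : ℚ) : qPow q (x + y) = qPow q x * qPow q y := by
  rw [qPow, Rat.cast_add, Complex.cpow_add _ _ hq0, qPow, qPow]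

theorem qPow_intCast (q : ℂ) (n : ℤ) : qPow q n = q ^ n := by
  rw [qPow, Rat.cast_intCast, Complex.cpow_intCast]

theorem innerLeft_diffVec (hq0 : q ≠ 0) {N : ℕ} [NeZero N] {L : ℤ} {K : Fin (N - 1) → ℤ}
    (hK : K ∈ convexPaths (N - 1) L) :
    qPow q ((L : ℚ) ^ 2 / N) * innerLeft q N (diffVec K L) = pathWeight q (etaKernel q) K L := by
  rw [innerLeft, ← mul_div_assoc, ← qPow_add hq0, quadForm_diffVec hK, qPow_intCast,
    pathWeight, Nat.sub_add_cancel NeZero.one_le, Finset.prod_range, div_eq_mul_inv,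
    ← Finset.prod_inv_distrib]
  congr 1
  refine Finset.prod_congr rfl fun i _ => ?_
  rw [← recPoch_natCast, natCast_diffVec hK, etaKernel, secondDiff]
  congr 1
  ring

theorem support_pathWeight_etaKernel_subset (q : ℂ) (d : ℕ) (L : ℤ) :
    (Function.support fun K : Fin d → ℤ => pathWeight q (etaKernel q) K L) ⊆ convexPaths d L := by
  intro K hK i
  by_contra hi
  rw [secondDiff] at hi
  refine hK ?_
  dsimp only
  rw [pathWeight, Finset.prod_eq_zero (Finset.mem_range.mpr i.2) (recPoch_of_neg q (by omega)),
    mul_zero]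

theorem tsum_innerLeft (hq0 : q ≠ 0) (hq : ‖q‖ < 1) (N : ℕ) [NeZero N] (L : ℤ) :
    (qPochInf q)⁻¹ * (qPow q ((L : ℚ) ^ 2 / N) * ∑' η : EtaIndex N L, innerLeft q N η.1) =
      levelGamma q (N - 1) L := by
  obtain ⟨C, hC⟩ := exists_norm_etaKernel_le hq
  rw [levelGamma, ← tsum_pathWeight hq0 hq hC, ← (etaEquiv N L).tsum_eq, ← tsum_mul_left,
    ← tsum_subtype_eq_of_support_subset (support_pathWeight_etaKernel_subset q _ L)]
  exact congrArg _ (tsum_congr fun K => innerLeft_diffVec hq0 K.2)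

theorem qBinom_symm (q : ℂ) (m n : ℕ) : qBinom q (m + n) n = qBinom q (m + n) m := by
  rw [qBinom, qBinom, if_pos (by omega), if_pos (by omega), Nat.add_sub_cancel,
    Nat.add_sub_cancel_left, mul_comm]

theorem innerRight_diffVec (hq0 : q ≠ 0) (hq : ‖q‖ < 1) {N : ℕ} [NeZero N] {L : ℕ}
    {K : Fin (N - 1) → ℤ} (hK : K ∈ nonnegConvexPaths (N - 1) L) :
    qPow q ((L : ℚ) ^ 2 / N) * innerRight q N (fun i => (2 * K i).toNat) (diffVec K L) =
      pathWeight q (gaussKernel q) K L := by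
  have hform := quadForm_diffVec hK.2
  rw [Int.cast_natCast] at hform
  rw [innerRight, ← mul_assoc, ← qPow_add hq0, hform, qPow_intCast, pathWeight,
    Nat.sub_add_cancel NeZero.one_le, Finset.prod_range]
  congr 1
  refine Finset.prod_congr rfl fun i _ => ?_
  have hKi : 0 ≤ K i := hK.1 i
  have hm : ((2 * K i).toNat : ℤ) = 2 * K i := Int.toNat_of_nonneg (by omega)
  have hvertex : pathExt K L (i + 1) = K i := pathExt_succ K L i.2
  have hn := natCast_diffVec hK.2 i
  rw [secondDiff, hvertex] at hn
  rw [qBinom_symm, ← gauss_natCast hq, gaussKernel, hvertex, gaussTrunc_of_nonneg q (by omega)]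
  push_cast
  rw [hn, hm]
  congr 1
  ring

theorem support_pathWeight_gaussKernel_subset (hq : ‖q‖ < 1) (d : ℕ) (L : ℤ) :
    (Function.support fun K : Fin d → ℤ => pathWeight q (gaussKernel q) K L) ⊆
      nonnegConvexPaths d L := by
  intro K hK
  have hvertex (i : Fin d) := Finset.prod_ne_zero_iff.mp (right_ne_zero_of_mul hK) i
    (Finset.mem_range.mpr i.2)
  refine ⟨fun i => ?_, fun i => ?_⟩
  · by_contra hi
    have hneg : 2 * pathExt K L (i + 1) < 0 := by
      rw [pathExt_succ K L i.2]
      exact mul_neg_of_pos_of_neg two_pos (not_le.mp hi)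
    exact hvertex i (gaussTrunc_of_neg_right q _ hneg)
  · by_contra hi
    rw [secondDiff] at hi
    exact hvertex i (gaussTrunc_of_lt hq (by omega))

theorem tsum_innerRight (hq0 : q ≠ 0) (hq : ‖q‖ < 1) (N : ℕ) [NeZero N] (L : ℕ) :
    qPow q ((L : ℚ) ^ 2 / N) * ∑' p : MNIndex N L, innerRight q N p.1.1 p.1.2 =
      levelDelta q (N - 1) L := by
  obtain ⟨C, hC⟩ := exists_norm_gaussKernel_le hq
  rw [levelDelta, ← tsum_pathWeight hq0 hq hC, ← (mnEquiv N L).tsum_eq, ← tsum_mul_left,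
    ← tsum_subtype_eq_of_support_subset (support_pathWeight_gaussKernel_subset hq _ L)]
  exact tsum_congr fun K => innerRight_diffVec hq0 hq K.2

theorem outerLeft_eq (hq0 : q ≠ 0) (k N : ℕ) (j : ℤ) :
    outerLeft q k N j = chainAlpha q k j * qPow q ((j : ℚ) ^ 2 / N) := by
  have htri : (2 * tri (j + 1) : ℚ) = (j + 1) * j := by
    have := two_mul_tri (j + 1)
    rw [add_sub_cancel_right] at this
    exact_mod_cast this
  have hexponent : ((2 * k + 1 + 2 / N) * j + 1) * j / 2 =
      ((tri (j + 1) + k * j ^ 2 : ℤ) : ℚ) + (j : ℚ) ^ 2 / N := by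
    push_cast
    linear_combination (-1 / 2 : ℚ) * htri
  rw [outerLeft, hexponent, qPow_add hq0, qPow_intCast, chainAlpha, mul_assoc]

theorem part_one {k : ℕ} (r : RIndex (k + 1)) : part r 1 = r.1 0 := by simp [part]

theorem part_succ_le {k : ℕ} (r : RIndex k) (i : ℕ) : part r (i + 2) ≤ part r (i + 1) := by
  unfold part
  split_ifs
  · exact r.2 (Fin.mk_le_mk.mpr (by omega))
  · omega
  · exact Nat.zero_le _
  · exact le_rfl

theorem outerRight_eq (hq0 : q ≠ 0) (k N : ℕ) (r : RIndex (k + 1)) :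
    outerRight q (k + 1) N r =
      qPow q ((part r 1 : ℚ) ^ 2 / N) * chainWeight q k (part r 1) (Fin.tail r.1) := by
  have hsum : ∑ i ∈ Finset.Icc 2 (k + 1), (part r i : ℚ) ^ 2 =
      ((∑ i ∈ Finset.range k, (part r (i + 1 + 1) : ℤ) ^ 2 : ℤ) : ℚ) := by
    rw [← Finset.Ico_add_one_right_eq_Icc, Finset.sum_Ico_eq_sum_range]
    push_cast
    exact Finset.sum_congr (by congr 1) fun i _ => by rw [add_comm 2 i]
  have hprod : ∏ i ∈ Finset.Icc 1 (k + 1), qPoch q (part r i - part r (i + 1)) =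
      ∏ i ∈ Finset.range (k + 1), qPoch q (part r (i + 1) - part r (i + 1 + 1)) := by
    rw [← Finset.Ico_add_one_right_eq_Icc, Finset.prod_Ico_eq_prod_range]
    exact Finset.prod_congr rfl fun i _ => by rw [add_comm 1 i]
  rw [outerRight, hsum, hprod, qPow_add hq0, qPow_intCast, mul_div_assoc, part_one,
    chainWeight_eq_prod hq0 k r.1 (fun i => part r (i + 1)) (fun i => by simp [part, i.2])
      (by simp [part])]
  congr 1
  rw [div_eq_mul_inv, ← Finset.prod_inv_distrib]
  congr 1
  refine Finset.prod_congr rfl fun i _ => ?_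
  rw [← Nat.cast_sub (part_succ_le r i), recPoch_natCast]

theorem antitone_cons_of_chainWeight_ne_zero {k x : ℕ} {r : Fin k → ℕ}
    (h : chainWeight q k x r ≠ 0) : Antitone (Fin.cons x r : Fin (k + 1) → ℕ) := by
  induction k generalizing x with
  | zero => exact Fin.antitone_iff_succ_le.mpr finZeroElim
  | succ k ih =>
    rw [chainWeight] at h
    have htail := ih (right_ne_zero_of_mul h)
    rw [Fin.cons_self_tail] at htail
    refine Fin.antitone_iff_succ_le.mpr fun i => ?_
    cases i using Fin.cases with
    | zero =>
      by_contra! hlt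
      refine left_ne_zero_of_mul h (mul_eq_zero_of_right _ (recPoch_of_neg q ?_))
      have : x < r 0 := hlt
      omega
    | succ i => exact Fin.antitone_iff_succ_le.mp htail i

theorem summable_outerLeft_mul_innerLeft (hq0 : q ≠ 0) (hq : ‖q‖ < 1) (k N : ℕ) [NeZero N] :
    Summable fun p : (j : ℤ) × EtaIndex N j => outerLeft q k N p.1 * innerLeft q N p.2.1 := by
  obtain ⟨C, hC⟩ := exists_norm_etaKernel_le hq
  have hα := summable_norm_chainAlpha hq0 hq k
  have hpaths : Summable fun p : (Fin (N - 1) → ℤ) × ℤ =>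
      chainAlpha q k p.2 * pathWeight q (etaKernel q) p.1 p.2 := by
    refine ((summable_norm_pathWeight hq0 hq hC (N - 1)).mul_left
      (∑' j, ‖chainAlpha q k j‖)).of_norm_bounded fun p => ?_
    rw [norm_mul]
    gcongr
    exact hα.le_tsum p.2 fun _ _ => norm_nonneg _
  have hinj : Function.Injective fun p : (j : ℤ) × convexPaths (N - 1) j => (p.2.1, p.1) := by
    rintro ⟨j, K, hK⟩ ⟨j', K', hK'⟩ h
    simp only [Prod.mk.injEq] at h
    obtain ⟨rfl, rfl⟩ := h
    rfl
  refine (Equiv.sigmaCongrRight (etaEquiv N)).summable_iff.mp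
    ((hpaths.comp_injective hinj).congr ?_)
  rintro ⟨j, K⟩
  change chainAlpha q k j * pathWeight q (etaKernel q) K.1 j =
    outerLeft q k N j * innerLeft q N (diffVec K.1 j)
  rw [← innerLeft_diffVec hq0 K.2, outerLeft_eq hq0, mul_assoc]

theorem summable_outerRight_mul_innerRight (hq0 : q ≠ 0) (hq : ‖q‖ < 1) (k N : ℕ) [NeZero N] :
    Summable fun p : (r : RIndex (k + 1)) × MNIndex N (part r 1) =>
      outerRight q (k + 1) N p.1 * innerRight q N p.2.1.1 p.2.1.2 := by
  obtain ⟨C, hC⟩ := exists_norm_gaussKernel_le hq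
  obtain ⟨g, hg, hgb⟩ := exists_norm_chainWeight_le hq0 hq k
  have hpaths : Summable fun p : ((Fin (N - 1) → ℤ) × ℤ) × (Fin k → ℕ) =>
      pathWeight q (gaussKernel q) p.1.1 p.1.2 * chainWeight q k p.1.2 p.2 := by
    refine ((summable_norm_pathWeight hq0 hq hC (N - 1)).mul_of_nonneg hg
      (fun _ => norm_nonneg _) fun r => (norm_nonneg _).trans (hgb 0 r)).of_norm_bounded fun p => ?_
    rw [norm_mul]
    exact mul_le_mul_of_nonneg_left (hgb _ _) (norm_nonneg _)
  have hinj : Function.Injective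
      fun p : (r : RIndex (k + 1)) × nonnegConvexPaths (N - 1) (part r 1 : ℕ) =>
        ((p.2.1, (part p.1 1 : ℤ)), Fin.tail p.1.1) := by
    rintro ⟨r, K, hK⟩ ⟨r', K', hK'⟩ h
    simp only [Prod.mk.injEq, Nat.cast_inj, part_one] at h
    obtain ⟨⟨rfl, hhead⟩, htail⟩ := h
    obtain rfl : r = r' := Subtype.ext (by
      rw [← Fin.cons_self_tail r.1, ← Fin.cons_self_tail r'.1, htail, hhead])
    rfl
  refine (Equiv.sigmaCongrRight fun r : RIndex (k + 1) => mnEquiv N (part r 1)).summable_iff.mp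
    ((hpaths.comp_injective hinj).congr ?_)
  rintro ⟨r, K⟩
  change pathWeight q (gaussKernel q) K.1 (part r 1 : ℕ) *
      chainWeight q k (part r 1 : ℕ) (Fin.tail r.1) =
    outerRight q (k + 1) N r * innerRight q N (fun i => (2 * K.1 i).toNat) (diffVec K.1 _)
  rw [← innerRight_diffVec hq0 hq K.2, outerRight_eq hq0, mul_right_comm]

theorem summable_levelDelta_mul_chainWeight (hq0 : q ≠ 0) (hq : ‖q‖ < 1) (d k : ℕ) :
    Summable fun r : Fin (k + 1) → ℕ =>
      levelDelta q d (r 0) * chainWeight q k (r 0) (Fin.tail r) := by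
  obtain ⟨g, hg, hgb⟩ := exists_norm_chainWeight_le hq0 hq k
  have hδ := (summable_norm_levelDelta hq0 hq d).comp_injective (Nat.cast_injective (R := ℤ))
  have hprod : Summable fun p : ℕ × (Fin k → ℕ) =>
      levelDelta q d p.1 * chainWeight q k p.1 p.2 := by
    refine (hδ.mul_of_nonneg hg (fun _ => norm_nonneg _)
      fun r => (norm_nonneg _).trans (hgb 0 r)).of_norm_bounded fun p => ?_
    rw [norm_mul]
    exact mul_le_mul_of_nonneg_left (hgb _ _) (norm_nonneg _)
  exact (Fin.consEquiv fun _ => ℕ).symm.summable_iff.mpr hprod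

theorem tsum_outerRight_mul_tsum_innerRight (hq0 : q ≠ 0) (hq : ‖q‖ < 1) (k N : ℕ) [NeZero N] :
    ∑' r : RIndex (k + 1), outerRight q (k + 1) N r *
        ∑' p : MNIndex N (part r 1), innerRight q N p.1.1 p.1.2 =
      ∑' r : ℕ, levelDelta q (N - 1) r * chainBeta q (k + 1) r := by
  let f (r : Fin (k + 1) → ℕ) : ℂ :=
    levelDelta q (N - 1) (r 0) * chainWeight q k (r 0) (Fin.tail r)
  have hf : Function.support f ⊆ {r | Antitone r} := fun r hr => by
    have := antitone_cons_of_chainWeight_ne_zero (right_ne_zero_of_mul hr)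
    rwa [Fin.cons_self_tail] at this
  have hterm (r : RIndex (k + 1)) : outerRight q (k + 1) N r *
      ∑' p : MNIndex N (part r 1), innerRight q N p.1.1 p.1.2 = f r.1 := by
    rw [outerRight_eq hq0, mul_right_comm, tsum_innerRight hq0 hq, part_one]
  let e : ℕ × (Fin k → ℕ) ≃ (Fin (k + 1) → ℕ) := Fin.consEquiv fun _ => ℕ
  have hsum := e.summable_iff.mpr (summable_levelDelta_mul_chainWeight hq0 hq (N - 1) k)
  calc _ = ∑' r : {r : Fin (k + 1) → ℕ | Antitone r}, f r := tsum_congr hterm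
    _ = ∑' p, f (e p) := by rw [tsum_subtype_eq_of_support_subset hf, e.tsum_eq]
    _ = ∑' (s : ℕ) (r : Fin k → ℕ), levelDelta q (N - 1) s * chainWeight q k s r :=
        hsum.tsum_prod
    _ = _ := tsum_congr fun s => by rw [tsum_mul_left, tsum_chainWeight hq0 hq]

theorem identity_of_ne_zero (hq0 : q ≠ 0) (hq : ‖q‖ < 1) (k N : ℕ) [NeZero N] :
    1 / qPochInf q * ∑' j : ℤ, outerLeft q (k + 1) N j * ∑' η : EtaIndex N j, innerLeft q N η.1 =
      ∑' r : RIndex (k + 1), outerRight q (k + 1) N r *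
        ∑' p : MNIndex N (part r 1), innerRight q N p.1.1 p.1.2 := by
  rw [tsum_outerRight_mul_tsum_innerRight hq0 hq, tsum_levelDelta_mul_chainBeta hq0 hq,
    ← tsum_mul_left]
  refine tsum_congr fun j => ?_
  rw [← tsum_innerLeft hq0 hq, outerLeft_eq hq0]
  ring

/-! ### The case `q = 0` -/

theorem qPow_zero_left (x : ℚ) : qPow 0 x = if x = 0 then 1 else 0 := by
  split_ifs with hx
  · rw [hx, qPow, Rat.cast_zero, Complex.cpow_zero]
  · rw [qPow, Complex.zero_cpow (Rat.cast_ne_zero.mpr hx)]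

theorem qPoch_zero_left (n : ℕ) : qPoch 0 n = 1 := by simp [qPoch]

theorem qPochInf_zero : qPochInf 0 = 1 := by simp [qPochInf]

theorem toRat_zero (d : ℕ) : toRat (0 : Fin d → ℕ) = 0 := by
  ext
  simp [toRat]

theorem exists_secondDiff_eq_toRat {N : ℕ} (v : Fin (N - 1) → ℕ) :
    ∃ K : ℕ → ℚ, K 0 = 0 ∧ K N = 0 ∧ toRat v = fun i : Fin (N - 1) => secondDiff K i := by
  let K (i : ℕ) : ℚ :=
    if h : 0 < i ∧ i < N then -((cartan N)⁻¹.mulVec (toRat v)) ⟨i - 1, by omega⟩ else 0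
  have h0 : K 0 = 0 := dif_neg (by omega)
  have hN : K N = 0 := dif_neg (by omega)
  have hK : (fun i : Fin (N - 1) => K (i + 1)) = -(cartan N)⁻¹.mulVec (toRat v) := by
    ext i
    exact dif_pos (by omega)
  refine ⟨K, h0, hN, ?_⟩
  have h := cartan_mulVec h0 hN
  rw [hK, Matrix.mulVec_neg, Matrix.mulVec_mulVec, Matrix.mul_nonsing_inv _ (isUnit_det_cartan N),
    Matrix.one_mulVec] at h
  exact neg_injective h

theorem quadForm_eq_zero_iff {N : ℕ} [NeZero N] {v : Fin (N - 1) → ℕ} :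
    quadForm N v = 0 ↔ v = 0 := by
  refine ⟨fun h => ?_, fun h => by rw [h, quadForm, toRat_zero, zero_dotProduct]⟩
  obtain ⟨K, h0, hN, hv⟩ := exists_secondDiff_eq_toRat v
  rw [quadForm_eq_sum_sq_sub h0 hv, hN, zero_pow two_ne_zero, zero_div, sub_zero,
    Finset.sum_eq_zero_iff_of_nonneg fun _ _ => sq_nonneg _] at h
  have hstep {i : ℕ} (hi : i < N) : K (i + 1) - K i = 0 :=
    pow_eq_zero_iff two_ne_zero |>.mp (h i (Finset.mem_range.mpr hi))
  ext i
  have hi : toRat v i = 0 := by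
    simp only [hv, secondDiff]
    linear_combination hstep (i := i + 1) (by omega) - hstep (i := i) (by omega)
  exact Nat.cast_eq_zero.mp hi

theorem innerLeft_zero_left {N : ℕ} [NeZero N] (η : Fin (N - 1) → ℕ) :
    innerLeft 0 N η = if η = 0 then 1 else 0 := by
  simp only [innerLeft, qPow_zero_left, quadForm_eq_zero_iff, qPoch_zero_left,
    Finset.prod_const_one, div_one]

theorem innerRight_zero_left {N : ℕ} [NeZero N] (m n : Fin (N - 1) → ℕ) :
    innerRight 0 N m n = if n = 0 then 1 else 0 := by
  have hbinom (a b : ℕ) : qBinom 0 (a + b) b = 1 := by simp [qBinom, qPoch_zero_left]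
  simp only [innerRight, qPow_zero_left, quadForm_eq_zero_iff, hbinom, Finset.prod_const_one,
    mul_one]

theorem outerLeft_zero_left {k : ℕ} (hk : 1 ≤ k) (N : ℕ) (j : ℤ) :
    outerLeft 0 k N j = if j = 0 then 1 else 0 := by
  rcases eq_or_ne j 0 with rfl | hj
  · simp [outerLeft, qPow_zero_left]
  have hk' : (1 : ℚ) ≤ k := by exact_mod_cast hk
  have hN : (0 : ℚ) ≤ 2 / N := by positivity
  have hj' : (1 : ℚ) ≤ j ^ 2 := by exact_mod_cast Order.one_le_iff_pos.mpr (by positivity)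
  have hexponent : 0 < ((2 * k + 1 + 2 / N) * j + 1) * (j : ℚ) := by
    nlinarith [sq_nonneg ((j : ℚ) + 1), mul_nonneg hN (sq_nonneg (j : ℚ)),
      mul_nonneg (sub_nonneg.mpr hk') (sq_nonneg (j : ℚ))]
  rw [outerLeft, qPow_zero_left, if_neg (by positivity), mul_zero, if_neg hj]

theorem part_le_part_one {k : ℕ} (r : RIndex k) (i : ℕ) : part r (i + 1) ≤ part r 1 := by
  induction i with
  | zero => exact le_rfl
  | succ i ih => exact (part_succ_le r i).trans ih

theorem part_one_eq_zero_iff {k : ℕ} {r : RIndex k} : part r 1 = 0 ↔ r.1 = 0 := by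
  refine ⟨fun h => funext fun i => Nat.eq_zero_of_le_zero ?_, fun h => by simp [part, h]⟩
  have hpart : part r (i + 1) = r.1 i := by simp [part]
  exact (hpart.symm.le.trans (part_le_part_one r i)).trans h.le

theorem outerRight_zero_left (k N : ℕ) [NeZero N] (r : RIndex k) :
    outerRight 0 k N r = if r.1 = 0 then 1 else 0 := by
  simp only [outerRight, qPoch_zero_left, Finset.prod_const_one, div_one, qPow_zero_left]
  refine if_congr ?_ rfl rfl
  have hN : (0 : ℚ) < N := by exact_mod_cast NeZero.pos N
  have hsum : 0 ≤ ∑ i ∈ Finset.Icc 2 k, (part r i : ℚ) ^ 2 := by positivity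
  refine ⟨fun h => part_one_eq_zero_iff.mp ?_, fun h => by simp [part, h]⟩
  by_contra hpart
  have : 0 < (part r 1 : ℚ) := by exact_mod_cast Nat.pos_of_ne_zero hpart
  exact (add_pos_of_pos_of_nonneg (by positivity) hsum).ne' h

theorem integralShift_zero (N : ℕ) : IntegralShift N 0 0 := ⟨0, by simp [toRat_zero]⟩

theorem mnSystem_zero_right_iff {N : ℕ} [NeZero N] {m : Fin (N - 1) → ℕ} :
    MNSystem N 0 m 0 ↔ m = 0 := by
  have hzero (i : Fin (N - 1)) : secondDiff (pathExt (0 : Fin (N - 1) → ℤ) 0) i = 0 := by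
    simp [secondDiff, pathExt]
  have hdiff : diffVec (0 : Fin (N - 1) → ℤ) ((0 : ℕ) : ℤ) = 0 :=
    funext fun i => by simp [diffVec, hzero]
  have h := mnSystem_diffVec_iff (L := 0) (m := m) fun i => (hzero i).ge
  rw [hdiff] at h
  rw [h, funext_iff]
  simp

theorem hasSum_innerLeft_zero_left (N : ℕ) [NeZero N] :
    HasSum (fun η : EtaIndex N 0 => innerLeft 0 N η.1) 1 := by
  convert hasSum_single (f := fun η : EtaIndex N 0 => innerLeft 0 N η.1)
    ⟨0, integralShift_zero N⟩ fun η hη => ?_ using 1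
  · simp [innerLeft_zero_left]
  · exact (innerLeft_zero_left _).trans (if_neg fun h => hη (Subtype.ext h))

theorem hasSum_innerRight_zero_left {N L : ℕ} [NeZero N] (hL : L = 0) :
    HasSum (fun p : MNIndex N L => innerRight 0 N p.1.1 p.1.2) 1 := by
  subst hL
  convert hasSum_single (f := fun p : MNIndex N 0 => innerRight 0 N p.1.1 p.1.2)
    ⟨0, integralShift_zero N, mnSystem_zero_right_iff.mpr rfl⟩ fun p hp => ?_ using 1
  · simp [innerRight_zero_left]
  · refine (innerRight_zero_left _ _).trans (if_neg fun hn => hp (Subtype.ext (Prod.ext ?_ hn)))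
    have hmn := p.2.2
    rw [show p.1.2 = 0 from hn] at hmn
    exact mnSystem_zero_right_iff.mp hmn

theorem summable_outerLeft_mul_innerLeft_zero_left {k : ℕ} (hk : 1 ≤ k) (N : ℕ) [NeZero N] :
    Summable fun p : (j : ℤ) × EtaIndex N j => outerLeft 0 k N p.1 * innerLeft 0 N p.2.1 := by
  refine (Function.Injective.summable_iff (sigma_mk_injective (i := (0 : ℤ))) ?_).mp
    ((hasSum_innerLeft_zero_left N).summable.mul_left (outerLeft 0 k N 0))
  rintro ⟨j, η⟩ hp
  have hj : j ≠ 0 := by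
    rintro rfl
    exact hp ⟨η, rfl⟩
  rw [outerLeft_zero_left hk, if_neg hj, zero_mul]

theorem summable_outerRight_mul_innerRight_zero_left (k N : ℕ) [NeZero N] :
    Summable fun p : (r : RIndex k) × MNIndex N (part r 1) =>
      outerRight 0 k N p.1 * innerRight 0 N p.2.1.1 p.2.1.2 := by
  let r₀ : RIndex k := ⟨0, antitone_const⟩
  have hinner := hasSum_innerRight_zero_left (N := N) (part_one_eq_zero_iff (r := r₀).mpr rfl)
  refine (Function.Injective.summable_iff (sigma_mk_injective (i := r₀)) ?_).mp
    (hinner.summable.mul_left (outerRight 0 k N r₀))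
  rintro ⟨r, p⟩ hp
  have hr : r.1 ≠ 0 := by
    intro h
    obtain rfl : r = r₀ := Subtype.ext h
    exact hp ⟨p, rfl⟩
  rw [outerRight_zero_left, if_neg hr, zero_mul]

theorem identity_zero_left {k : ℕ} (hk : 1 ≤ k) (N : ℕ) [NeZero N] :
    1 / qPochInf 0 * ∑' j : ℤ, outerLeft 0 k N j * ∑' η : EtaIndex N j, innerLeft 0 N η.1 =
      ∑' r : RIndex k, outerRight 0 k N r *
        ∑' p : MNIndex N (part r 1), innerRight 0 N p.1.1 p.1.2 := by
  let r₀ : RIndex k := ⟨0, antitone_const⟩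
  rw [qPochInf_zero, tsum_eq_single (0 : ℤ) fun j hj => by
      rw [outerLeft_zero_left hk, if_neg hj, zero_mul],
    (hasSum_innerLeft_zero_left N).tsum_eq,
    tsum_eq_single r₀ fun r hr => by
      rw [outerRight_zero_left, if_neg fun h => hr (Subtype.ext h), zero_mul],
    (hasSum_innerRight_zero_left (part_one_eq_zero_iff.mpr rfl)).tsum_eq,
    outerLeft_zero_left hk, outerRight_zero_left, if_pos rfl, if_pos rfl, div_one, mul_one, mul_one]

end

end HigherBailey

theorem mainTheorem3 (k N : ℕ) (hk : 1 ≤ k) (hN : 1 ≤ N) (q : ℂ) (hq : ‖q‖ < 1) :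
    (Summable fun p : (j : ℤ) × HigherBailey.EtaIndex N j =>
      HigherBailey.outerLeft q k N p.1 * HigherBailey.innerLeft q N p.2.1) ∧
    (Summable fun p : (r : HigherBailey.RIndex k) × HigherBailey.MNIndex N (HigherBailey.part r 1) =>
      HigherBailey.outerRight q k N p.1 * HigherBailey.innerRight q N p.2.1.1 p.2.1.2) ∧
    1 / HigherBailey.qPochInf q *
        ∑' j : ℤ, HigherBailey.outerLeft q k N j *
          ∑' η : HigherBailey.EtaIndex N j, HigherBailey.innerLeft q N η.1 =
      ∑' r : HigherBailey.RIndex k, HigherBailey.outerRight q k N r *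
        ∑' p : HigherBailey.MNIndex N (HigherBailey.part r 1),
          HigherBailey.innerRight q N p.1.1 p.1.2 := by
  obtain ⟨k, rfl⟩ : ∃ k', k = k' + 1 := ⟨k - 1, by omega⟩
  have : NeZero N := ⟨by omega⟩
  rcases eq_or_ne q 0 with rfl | hq0
  · exact ⟨HigherBailey.summable_outerLeft_mul_innerLeft_zero_left hk N,
      HigherBailey.summable_outerRight_mul_innerRight_zero_left (k + 1) N,
      HigherBailey.identity_zero_left hk N⟩
  · exact ⟨HigherBailey.summable_outerLeft_mul_innerLeft hq0 hq (k + 1) N,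
      HigherBailey.summable_outerRight_mul_innerRight hq0 hq k N,
      HigherBailey.identity_of_ne_zero hq0 hq k N⟩
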